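/- Let $K\ge 1$ and let $Q=(q_{ij})$ be the generator of an irreducible continuous-time Markov chain (CTMC) on $\{1,\dots,K\}$ with stationary distribution $\pi=(\pi_1,\dots,\pi_K)$, and assume that the chain is time-reversible: $\pi_i q_{ij}=\pi_j q_{ji}$ for all $i\ne j$. Put $\Pi=\mathrm{diag}(\pi_1,\dots,\pi_K)$ and $S=\Pi^{1/2}Q\,\Pi^{-1/2}$, let $U$ be an orthogonal matrix with $U^{T}SU=\mathrm{diag}(-d_1,\dots,-d_{K-1},0)$, and let $T=\Pi^{-1/2}U=(t_{ij})$ and $T^{-1}=(\tilde t_{ij})$. For $1\le j\le K-1$ put $$b_j=\sum_{i=1}^K\pi_i^2t_{ij}^2,\qquad a_j=b_jd_j .$$ Let $X(t)$, $t\ge 0$, be a CTMC with generator $Q$ and arbitrary initial law, sampled at the points of an independent Poisson process of rate $\lambda>0$. Let $\tilde X(t)=X(t')$, where $t'$ is the latest sampling time up to time $t$ (before the first sample, $\tilde X$ is an arbitrary random initial estimate). In the fresh-when-equal (FWE) model the freshness process is $F(t)=1$ if $\tilde X(t)=X(t)$ and $F(t)=0$ otherwise. The mean freshness $f(\lambda)$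 is the steady-state probability $\lim_{t\to\infty}\mathbb P[\tilde X(t)=X(t)]$, which is also the almost sure long-run time average $\lim_{\tau\to\infty}\frac1\tau\int_0^\tau F(t)\,dt$. Then both limits exist and coincide, their common value $f(\lambda)$ depends only on $Q$ and $\lambda$, and for every $\lambda>0$ $$f(\lambda)=\sum_{j=1}^K\pi_j^2+\lambda\sum_{j=1}^{K-1}\frac{b_j}{\lambda+d_j}=1-\sum_{j=1}^{K-1}\frac{a_j}{\lambda+d_j}.$$ Moreover, for $1\le j\le K-1$, $b_j=\sum_{i=1}^K\tilde t_{ji}^{\,2}$ and $d_j,b_j,a_j>0$. The function $f$ has a continuous derivative on $(0,\infty)$, $\lim_{\lambda\to0^+}f(\lambda)=\sum_{j=1}^K\pi_j^2$, and if $K\ge2$, then $f$ is strictly increasing and strictly concave on $(0,\infty)$. -/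

import Mathlib

open MeasureTheory ProbabilityTheory Filter Topology Matrix
open scoped NNReal

universe u

noncomputable section

namespace SampledCTMC

/-! ### Generators of finite-state continuous-time Markov chains -/

section Generator

variable {S : Type*} [Fintype S] [DecidableEq S]

/-- `Q` is an infinitesimal generator: nonnegative off-diagonal rates and zero row sums. -/
structure IsGenerator (Q : Matrix S S ℝ) : Prop where
  nonneg_off_diag : ∀ i j, i ≠ j → 0 ≤ Q i j
  row_sum : ∀ i, ∑ j, Q i j = 0

/-- The transition probability `P_t(i, j)`, an entry of the matrix `exp (t Q)`. -/
def transitionProb (Q : Matrix S S ℝ) (t : ℝ≥0) (i j : S) : ℝ :=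
  NormedSpace.exp ((t : ℝ) • Q) i j

/-- From any state one gets to any other state in some finite time with positive probability. -/
def IsIrreducible (Q : Matrix S S ℝ) : Prop :=
  ∀ i j, ∃ t : ℝ≥0, 0 < transitionProb Q t i j

/-- `p` is a stationary distribution: a probability vector satisfying global balance `p Q = 0`. -/
structure IsStationary (Q : Matrix S S ℝ) (p : S → ℝ) : Prop where
  nonneg : ∀ i, 0 ≤ p i
  sum_eq_one : ∑ i, p i = 1
  balance : p ᵥ* Q = 0

/-- Time-reversibility, through the detailed balance equations. -/
def IsReversible (Q : Matrix S S ℝ) (p : S → ℝ) : Prop :=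
  ∀ i j, i ≠ j → p i * Q i j = p j * Q j i

/-- The symmetrized generator `Π^{1/2} Q Π^{-1/2}`, with `Π = diag p`. -/
def symmetrizedGenerator (Q : Matrix S S ℝ) (p : S → ℝ) : Matrix S S ℝ :=
  diagonal (fun i => √(p i)) * Q * diagonal (fun i => (√(p i))⁻¹)

/-- The diagonalizing matrix `T = Π^{-1/2} U`, with `Π = diag p`. -/
def diagonalizer (p : S → ℝ) (U : Matrix S S ℝ) : Matrix S S ℝ :=
  diagonal (fun i => (√(p i))⁻¹) * U

end Generator

/-! ### The processes -/

section Processes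

variable {S : Type*} [Fintype S] [DecidableEq S] [MeasurableSpace S]
variable {Ω : Type*} [MeasurableSpace Ω]

/-- `X` is a continuous-time Markov chain with generator `Q` (and arbitrary initial law): it has
right-continuous paths, and the conditional probability of `X s = j` given the values of `X` at
times `t 0 ≤ ⋯ ≤ t m ≤ s` is `P_{s - t m}(X (t m), j)`. -/
structure IsCTMC (P : Measure Ω) (Q : Matrix S S ℝ) (X : ℝ≥0 → Ω → S) : Prop where
  measurable : ∀ t, Measurable (X t)
  right_continuous : ∀ ω t, ∀ᶠ s in 𝓝[>] t, X s ω = X t ω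
  markov : ∀ (m : ℕ) (t : Fin (m + 1) → ℝ≥0), Monotone t →
    ∀ (i : Fin (m + 1) → S) (s : ℝ≥0), t (Fin.last m) ≤ s → ∀ j : S,
      P.real {ω | (∀ k, X (t k) ω = i k) ∧ X s ω = j} =
        P.real {ω | ∀ k, X (t k) ω = i k} *
          transitionProb Q (s - t (Fin.last m)) (i (Fin.last m)) j

/-- `N` is the counting process of a Poisson process with intensity `r`. -/
structure IsPoissonProcess (P : Measure Ω) (r : ℝ≥0) (N : ℝ≥0 → Ω → ℕ) : Prop where
  measurable : ∀ t, Measurable (N t)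
  zero : ∀ ω, N 0 ω = 0
  mono : ∀ ω, Monotone (fun t => N t ω)
  right_continuous : ∀ ω t, ∀ᶠ s in 𝓝[>] t, N s ω = N t ω
  indep_increments : HasIndepIncrements N P
  law_increment : ∀ s t, s ≤ t →
    HasLaw (fun ω => N t ω - N s ω) (poissonMeasure (r * (t - s))) P

/-- `s` is a sampling time: the counting process `N` jumps at `s`. -/
def IsSamplingTime (N : ℝ≥0 → Ω → ℕ) (ω : Ω) (s : ℝ≥0) : Prop :=
  0 < s ∧ ∀ r < s, N r ω < N s ω

/-- The latest sampling time not after `t` (if there is one). -/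
def latestSamplingTime (N : ℝ≥0 → Ω → ℕ) (t : ℝ≥0) (ω : Ω) : ℝ≥0 :=
  sSup {s | s ≤ t ∧ IsSamplingTime N ω s}

open Classical in
/-- The martingale estimator: the state of `X` at the latest sampling time, and an
initial guess `x₀` as long as no sample has been taken. -/
def estimator (X : ℝ≥0 → Ω → S) (N : ℝ≥0 → Ω → ℕ) (x₀ : Ω → S) (t : ℝ≥0) (ω : Ω) : S :=
  if ∃ s ≤ t, IsSamplingTime N ω s then X (latestSamplingTime N t ω) ω else x₀ ω

/-- The fresh-when-equal freshness process: `1` if estimator and source agree, else `0`. -/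
def freshness (X : ℝ≥0 → Ω → S) (N : ℝ≥0 → Ω → ℕ) (x₀ : Ω → S) (t : ℝ≥0) (ω : Ω) : ℝ :=
  if estimator X N x₀ t ω = X t ω then 1 else 0

/-- A Markov chain `X` with generator `Q`, sampled at the points of an independent Poisson process
`N` of intensity `r`, with an arbitrary (random) initial estimate `x₀`. -/
structure IsPoissonSampled (P : Measure Ω) (Q : Matrix S S ℝ) (r : ℝ≥0)
    (X : ℝ≥0 → Ω → S) (N : ℝ≥0 → Ω → ℕ) (x₀ : Ω → S) : Prop where
  chain : IsCTMC P Q X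
  poisson : IsPoissonProcess P r N
  indep : IndepFun (fun ω t => X t ω) (fun ω t => N t ω) P
  measurable_init : Measurable x₀

/-- `m` is the mean freshness `E[F]`: the steady-state probability `lim P[X̃(t) = X(t)]` exists and
equals `m`, and almost surely so does the long-run time average of the freshness process. -/
structure IsMeanFreshness (P : Measure Ω) (X : ℝ≥0 → Ω → S) (N : ℝ≥0 → Ω → ℕ) (x₀ : Ω → S)
    (m : ℝ) : Prop where
  steady_state : Tendsto (fun t => P.real {ω | estimator X N x₀ t ω = X t ω}) atTop (𝓝 m)
  time_average : ∀ᵐ ω ∂P,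
    Tendsto (fun τ : ℝ => τ⁻¹ * ∫ t in (0 : ℝ)..τ, freshness X N x₀ t.toNNReal ω) atTop (𝓝 m)

end Processes

end SampledCTMC

end

/-! Detailed balance makes `Q` similar to a symmetric matrix, so the columns of `T` are eigenvectors
of `Q`, orthonormal in L²(p). The Dirichlet form shows that the eigenvalues are nonpositive, and
irreducibility that 0 is simple with constant eigenvector ±1 (`eigenvalue_neg`). Hence the
transition probabilities approach `p` exponentially fast, and in equilibrium the chain is back in
its starting state after time v with probability Σ pᵢ² + Σ bⱼ exp(-dⱼ v) (`sum_mul_transitionProb`).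

At a late time the age of the latest sample is nearly exponential of rate r and independent of the
source. The mean freshness is therefore the return probability averaged against r exp(-r v) dv,
which is the first closed form. At v = 0 the return probability is 1, so Σ pᵢ² + Σ bⱼ = 1. This
turns the first form into the second, from which regularity, monotonicity, concavity and the limit
at 0 are read off.

The Markov property is available at deterministic times only, whereas the sample is taken at a
random one. So the last sample in (u, t] is located in a cell of a finite grid and the source is
read at the right end of that cell; right-continuity makes this exact in the limit
(`tendsto_sum_indicator_gridEvent`). On the grid everything is a finite sum of transition and
Poisson probabilities, and the mixing errors, weighted by the probabilities of disjoint cells, are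
bounded independently of the mesh. The limit gives the probability of being fresh through a sample
after u, and the joint probability for two successive intervals
(`abs_measureReal_freshSince_sub_le`, `abs_measureReal_freshSince_inter_sub_le`).

The initial guess matters only while no sample has been taken, an event of exponentially small
probability. The one-interval estimate then yields the steady state, and the two-interval estimate
covariances of order exp(-c(t-s)) + exp(-cs). Such decay makes the second moments of the centred
averages over [0, k²] summable, and boundedness fills the gaps between squares
(`ae_tendsto_average`). -/

set_option linter.unusedSectionVars false

/-! ### Spectral theory of an irreducible reversible generator -/

namespace SampledCTMC

section Spectral

variable {S : Type*} [Fintype S] [DecidableEq S] {Q : Matrix S S ℝ} {p : S → ℝ}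

/-- The stationary probabilities of an irreducible reversible chain are positive. -/
theorem IsStationary.pos (hp : IsStationary Q p) (hirr : IsIrreducible Q)
    (hrev : IsReversible Q p) (i : S) : 0 < p i := by
  classical
  by_contra hi
  obtain ⟨j, hj⟩ : ∃ j, 0 < p j := by
    by_contra! h
    have := Finset.sum_nonpos (fun i (_ : i ∈ Finset.univ) => h i)
    rw [hp.sum_eq_one] at this
    linarith
  -- Detailed balance forbids transitions out of the support of `p`. Hence `Q`, and with it every
  -- `exp (t Q)`, is block triangular, so a state outside the support could not be reached from `j`.
  have hQ : BlockTriangular Q (fun k => if 0 < p k then 1 else 0) := by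
    intro k l hkl
    have hk : 0 < p k := by
      by_contra hk
      simp [hk] at hkl
    have hl : p l = 0 := by
      refine le_antisymm ?_ (hp.nonneg l)
      by_contra! hl
      simp [hk, hl] at hkl
    have hne : k ≠ l := by
      rintro rfl
      exact hk.ne' hl
    have := hrev k l hne
    rw [hl, zero_mul] at this
    exact (mul_eq_zero.1 this).resolve_left hk.ne'
  obtain ⟨t, ht⟩ := hirr j i
  have htQ : BlockTriangular ((t : ℝ) • Q) (fun k => if 0 < p k then 1 else 0) := by
    intro k l hkl
    rw [Matrix.smul_apply, hQ hkl, smul_zero]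
  have h0 := htQ.exp (i := j) (j := i) (by simp [hi, hj])
  exact ht.ne' h0

/-- A function that is constant along the transitions of an irreducible chain is constant. -/
theorem IsIrreducible.eq_of_mul_eq (hirr : IsIrreducible Q) {f : S → ℝ}
    (hf : ∀ i j, f i * Q i j = Q i j * f j) (i j : S) : f i = f j := by
  obtain ⟨t, ht⟩ := hirr i j
  -- The hypothesis says that `diagonal f` commutes with `Q`; it then commutes with `exp (t Q)`,
  -- whose entry at `(i, j)` is positive for a suitable `t`.
  have hc : Commute (diagonal f) ((t : ℝ) • Q) := by
    refine Commute.smul_right ?_ _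
    ext k l
    simp [diagonal_mul, mul_diagonal, hf]
  have h := congrFun (congrFun hc.exp_right i) j
  rw [diagonal_mul, mul_diagonal, mul_comm] at h
  exact mul_left_cancel₀ ht.ne' h

/-- The Dirichlet form of a generator with respect to a stationary distribution. -/
theorem IsGenerator.dirichlet_form (hQ : IsGenerator Q) (hp : IsStationary Q p) (f : S → ℝ) :
    ∑ i, p i * f i * (Q *ᵥ f) i = -(1 / 2) * ∑ i, ∑ j, p i * Q i j * (f i - f j) ^ 2 := by
  -- In the expanded square, the terms in `f i ^ 2` cancel by the zero row sums and those in `f j ^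
  -- 2` by global balance; only the cross term survives.
  have h1 : ∑ i, ∑ j, p i * Q i j * f i ^ 2 = 0 := by
    refine Finset.sum_eq_zero fun i _ => ?_
    calc ∑ j, p i * Q i j * f i ^ 2 = p i * f i ^ 2 * ∑ j, Q i j := by
          rw [Finset.mul_sum]
          exact Finset.sum_congr rfl fun j _ => by ring
      _ = 0 := by rw [hQ.row_sum, mul_zero]
  have h2 : ∑ i, ∑ j, p i * Q i j * f j ^ 2 = 0 := by
    rw [Finset.sum_comm]
    refine Finset.sum_eq_zero fun j _ => ?_
    have hb : ∑ i, p i * Q i j = 0 := congrFun hp.balance j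
    rw [← Finset.sum_mul, hb, zero_mul]
  have h3 : ∑ i, p i * f i * (Q *ᵥ f) i = ∑ i, ∑ j, p i * Q i j * (f i * f j) := by
    refine Finset.sum_congr rfl fun i _ => ?_
    rw [Matrix.mulVec, dotProduct, Finset.mul_sum]
    exact Finset.sum_congr rfl fun j _ => by ring
  have h4 : ∑ i, ∑ j, p i * Q i j * (f i - f j) ^ 2 =
      ∑ i, ∑ j, p i * Q i j * f i ^ 2 - 2 * ∑ i, ∑ j, p i * Q i j * (f i * f j)
        + ∑ i, ∑ j, p i * Q i j * f j ^ 2 := by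
    simp only [Finset.mul_sum, ← Finset.sum_add_distrib, ← Finset.sum_sub_distrib]
    exact Finset.sum_congr rfl fun i _ => Finset.sum_congr rfl fun j _ => by ring
  rw [h3, h4, h1, h2]
  ring

theorem IsGenerator.sum_mul_mulVec_nonpos (hQ : IsGenerator Q) (hp : IsStationary Q p)
    (f : S → ℝ) : ∑ i, p i * f i * (Q *ᵥ f) i ≤ 0 := by
  rw [hQ.dirichlet_form hp]
  have : 0 ≤ ∑ i, ∑ j, p i * Q i j * (f i - f j) ^ 2 := by
    refine Finset.sum_nonneg fun i _ => Finset.sum_nonneg fun j _ => ?_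
    obtain rfl | hij := eq_or_ne i j
    · simp
    · exact mul_nonneg (mul_nonneg (hp.nonneg i) (hQ.nonneg_off_diag i j hij)) (sq_nonneg _)
  linarith

/-- A function in the kernel of the Dirichlet form is constant. -/
theorem IsGenerator.eq_of_sum_mul_mulVec_eq_zero (hQ : IsGenerator Q) (hirr : IsIrreducible Q)
    (hp : IsStationary Q p) (hpos : ∀ i, 0 < p i) {f : S → ℝ}
    (hf : ∑ i, p i * f i * (Q *ᵥ f) i = 0) (i j : S) : f i = f j := by
  have hnn : ∀ i j, 0 ≤ p i * Q i j * (f i - f j) ^ 2 := by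
    intro i j
    obtain rfl | hij := eq_or_ne i j
    · simp
    · exact mul_nonneg (mul_nonneg (hp.nonneg i) (hQ.nonneg_off_diag i j hij)) (sq_nonneg _)
  have h0 : ∑ i, ∑ j, p i * Q i j * (f i - f j) ^ 2 = 0 := by
    rw [hQ.dirichlet_form hp] at hf
    linarith
  rw [Finset.sum_eq_zero_iff_of_nonneg fun i _ => Finset.sum_nonneg fun j _ => hnn i j] at h0
  refine hirr.eq_of_mul_eq (fun k l => ?_) i j
  have h1 := h0 k (Finset.mem_univ k)
  rw [Finset.sum_eq_zero_iff_of_nonneg fun j _ => hnn k j] at h1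
  have h2 := h1 l (Finset.mem_univ l)
  rcases mul_eq_zero.1 h2 with h | h
  · have : Q k l = 0 := (mul_eq_zero.1 h).resolve_left (hpos k).ne'
    simp [this]
  · have : f k = f l := sub_eq_zero.1 (pow_eq_zero_iff (two_ne_zero)|>.1 h)
    rw [this, mul_comm]

variable {U : Matrix S S ℝ} {D : S → ℝ}

theorem diagonalizer_apply (p : S → ℝ) (U : Matrix S S ℝ) (i k : S) :
    diagonalizer p U i k = (√(p i))⁻¹ * U i k := by
  simp [diagonalizer, diagonal_mul]

theorem diagonalizer_mul_eq_one (hpos : ∀ i, 0 < p i) (hU : Uᵀ * U = 1) :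
    diagonalizer p U * (Uᵀ * diagonal (fun i => √(p i))) = 1 := by
  have hU' : U * Uᵀ = 1 := mul_eq_one_comm.1 hU
  rw [diagonalizer, Matrix.mul_assoc, ← Matrix.mul_assoc U, hU', Matrix.one_mul,
    diagonal_mul_diagonal, ← diagonal_one]
  congr 1
  funext i
  exact inv_mul_cancel₀ (Real.sqrt_pos.2 (hpos i)).ne'

theorem diagonalizer_inv (hpos : ∀ i, 0 < p i) (hU : Uᵀ * U = 1) :
    (diagonalizer p U)⁻¹ = Uᵀ * diagonal (fun i => √(p i)) :=
  inv_eq_right_inv (diagonalizer_mul_eq_one hpos hU)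

theorem isUnit_diagonalizer (hpos : ∀ i, 0 < p i) (hU : Uᵀ * U = 1) :
    IsUnit (diagonalizer p U) :=
  IsUnit.of_mul_eq_one _ (diagonalizer_mul_eq_one hpos hU)

/-- Orthogonality of `U` gives T⁻¹ = Uᵀ Π^{1/2} = Tᵀ Π. This yields both the second expression for
`b` and the weight `p j` in the spectral representation. -/
theorem diagonalizer_inv_apply (hpos : ∀ i, 0 < p i) (hU : Uᵀ * U = 1) (k i : S) :
    (diagonalizer p U)⁻¹ k i = p i * diagonalizer p U i k := by
  rw [diagonalizer_inv hpos hU, mul_diagonal, transpose_apply, diagonalizer_apply]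
  have h := Real.sqrt_pos.2 (hpos i)
  have h2 := Real.mul_self_sqrt (hpos i).le
  field_simp
  rw [sq, h2]

/-- The columns of `T` are orthonormal with respect to the stationary distribution. -/
theorem sum_mul_diagonalizer (hpos : ∀ i, 0 < p i) (hU : Uᵀ * U = 1) (k l : S) :
    ∑ i, p i * diagonalizer p U i k * diagonalizer p U i l = if k = l then 1 else 0 := by
  have h : (diagonalizer p U)⁻¹ * diagonalizer p U = 1 := by
    rw [diagonalizer_inv hpos hU]
    exact mul_eq_one_comm.1 (diagonalizer_mul_eq_one hpos hU)
  have h2 := congrFun (congrFun h k) l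
  rw [mul_apply, one_apply] at h2
  rw [← h2]
  exact Finset.sum_congr rfl fun i _ => by rw [diagonalizer_inv_apply hpos hU]

/-- Conjugation by Π^{1/2} turns the eigenvectors of the symmetrized generator into right
eigenvectors of `Q`. -/
theorem generator_mul_diagonalizer (hpos : ∀ i, 0 < p i) (hU : Uᵀ * U = 1)
    (hdiag : Uᵀ * symmetrizedGenerator Q p * U = diagonal D) :
    Q * diagonalizer p U = diagonalizer p U * diagonal D := by
  have hU' : U * Uᵀ = 1 := mul_eq_one_comm.1 hU
  have h1 : diagonal (fun i => (√(p i))⁻¹) * diagonal (fun i => √(p i)) = (1 : Matrix S S ℝ) := by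
    rw [diagonal_mul_diagonal, ← diagonal_one]
    congr 1
    funext i
    exact inv_mul_cancel₀ (Real.sqrt_pos.2 (hpos i)).ne'
  rw [← hdiag, diagonalizer, symmetrizedGenerator]
  calc Q * (diagonal (fun i => (√(p i))⁻¹) * U)
      = (diagonal (fun i => (√(p i))⁻¹) * diagonal (fun i => √(p i))) * Q *
          (diagonal (fun i => (√(p i))⁻¹) * U) := by rw [h1, Matrix.one_mul]
    _ = diagonal (fun i => (√(p i))⁻¹) * (U * Uᵀ) * diagonal (fun i => √(p i)) * Q *
          (diagonal (fun i => (√(p i))⁻¹) * U) := by rw [hU', Matrix.mul_one]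
    _ = _ := by simp only [Matrix.mul_assoc]

theorem generator_mulVec_diagonalizer (hpos : ∀ i, 0 < p i) (hU : Uᵀ * U = 1)
    (hdiag : Uᵀ * symmetrizedGenerator Q p * U = diagonal D) (k i : S) :
    (Q *ᵥ (fun i => diagonalizer p U i k)) i = D k * diagonalizer p U i k := by
  have h := congrFun (congrFun (generator_mul_diagonalizer hpos hU hdiag) i) k
  rw [mul_diagonal, mul_apply, mul_comm] at h
  exact h

/-- The columns of `T` have norm one in L²(p), so the quadratic form at an eigenvector is the
eigenvalue itself; signs of eigenvalues are thus read off from the Dirichlet form. -/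
theorem sum_mul_generator_mulVec (hpos : ∀ i, 0 < p i) (hU : Uᵀ * U = 1)
    (hdiag : Uᵀ * symmetrizedGenerator Q p * U = diagonal D) (k : S) :
    ∑ i, p i * diagonalizer p U i k * (Q *ᵥ (fun i => diagonalizer p U i k)) i = D k := by
  have h := sum_mul_diagonalizer hpos hU k k
  rw [if_pos rfl] at h
  simp only [generator_mulVec_diagonalizer hpos hU hdiag]
  calc ∑ i, p i * diagonalizer p U i k * (D k * diagonalizer p U i k)
      = D k * ∑ i, p i * diagonalizer p U i k * diagonalizer p U i k := by
        rw [Finset.mul_sum]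
        exact Finset.sum_congr rfl fun i _ => by ring
    _ = D k := by rw [h, mul_one]

/-- Spectral representation of the transition probabilities. -/
theorem transitionProb_eq_sum (hpos : ∀ i, 0 < p i) (hU : Uᵀ * U = 1)
    (hdiag : Uᵀ * symmetrizedGenerator Q p * U = diagonal D) (t : ℝ≥0) (i j : S) :
    transitionProb Q t i j =
      ∑ k, p j * diagonalizer p U i k * diagonalizer p U j k * Real.exp (D k * t) := by
  have hu := isUnit_diagonalizer hpos hU
  have hQ : (t : ℝ) • Q =
      diagonalizer p U * diagonal (fun k => t * D k) * (diagonalizer p U)⁻¹ := by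
    have hdet := (isUnit_iff_isUnit_det _).1 hu
    have h1 : diagonal (fun k => (t : ℝ) * D k) = (t : ℝ) • diagonal D := by
      ext a b
      by_cases hab : a = b <;> simp [hab]
    rw [h1, Matrix.mul_smul, ← generator_mul_diagonalizer hpos hU hdiag, Matrix.smul_mul,
      Matrix.mul_assoc, mul_nonsing_inv _ hdet, Matrix.mul_one]
  rw [transitionProb, hQ, exp_conj _ _ hu, exp_diagonal, mul_apply]
  refine Finset.sum_congr rfl fun k _ => ?_
  rw [mul_diagonal, diagonalizer_inv_apply hpos hU, Pi.coe_exp, ← Real.exp_eq_exp_ℝ,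
    mul_comm (t : ℝ)]
  ring

theorem eigenvalue_nonpos (hQ : IsGenerator Q) (hp : IsStationary Q p) (hpos : ∀ i, 0 < p i)
    (hU : Uᵀ * U = 1) (hdiag : Uᵀ * symmetrizedGenerator Q p * U = diagonal D) (k : S) :
    D k ≤ 0 := by
  rw [← sum_mul_generator_mulVec hpos hU hdiag k]
  exact hQ.sum_mul_mulVec_nonpos hp _

theorem diagonalizer_eq_of_eigenvalue_eq_zero (hQ : IsGenerator Q) (hirr : IsIrreducible Q)
    (hp : IsStationary Q p) (hpos : ∀ i, 0 < p i) (hU : Uᵀ * U = 1)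
    (hdiag : Uᵀ * symmetrizedGenerator Q p * U = diagonal D) {k : S} (hk : D k = 0) (i j : S) :
    diagonalizer p U i k = diagonalizer p U j k := by
  refine hQ.eq_of_sum_mul_mulVec_eq_zero hirr hp hpos (f := fun i => diagonalizer p U i k) ?_ i j
  rw [sum_mul_generator_mulVec hpos hU hdiag, hk]

/-- The column of `T` for the eigenvalue `0` is `± 1`. -/
theorem diagonalizer_mul_of_eigenvalue_eq_zero (hQ : IsGenerator Q) (hirr : IsIrreducible Q)
    (hp : IsStationary Q p) (hpos : ∀ i, 0 < p i) (hU : Uᵀ * U = 1)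
    (hdiag : Uᵀ * symmetrizedGenerator Q p * U = diagonal D) {k : S} (hk : D k = 0) (i j : S) :
    diagonalizer p U i k * diagonalizer p U j k = 1 := by
  have hc := diagonalizer_eq_of_eigenvalue_eq_zero hQ hirr hp hpos hU hdiag hk
  have h := sum_mul_diagonalizer hpos hU k k
  rw [if_pos rfl] at h
  calc diagonalizer p U i k * diagonalizer p U j k
      = (∑ l, p l) * (diagonalizer p U i k * diagonalizer p U j k) := by
        rw [hp.sum_eq_one, one_mul]
    _ = ∑ l, p l * diagonalizer p U l k * diagonalizer p U l k := by
        rw [Finset.sum_mul]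
        exact Finset.sum_congr rfl fun l _ => by rw [hc i l, hc j l]; ring
    _ = 1 := h

/-- The eigenvalue `0` is simple. -/
theorem eigenvalue_neg (hQ : IsGenerator Q) (hirr : IsIrreducible Q)
    (hp : IsStationary Q p) (hpos : ∀ i, 0 < p i) (hU : Uᵀ * U = 1)
    (hdiag : Uᵀ * symmetrizedGenerator Q p * U = diagonal D) {k l : S} (hk : D k = 0)
    (hkl : l ≠ k) : D l < 0 := by
  refine lt_of_le_of_ne (eigenvalue_nonpos hQ hp hpos hU hdiag l) fun hl => ?_
  have ck := diagonalizer_eq_of_eigenvalue_eq_zero hQ hirr hp hpos hU hdiag hk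
  have cl := diagonalizer_eq_of_eigenvalue_eq_zero hQ hirr hp hpos hU hdiag hl
  have h := sum_mul_diagonalizer hpos hU l k
  rw [if_neg hkl] at h
  -- Two columns with eigenvalue 0 are both constant, so their inner product is the product of the
  -- two constants. Each constant has square 1, against orthogonality.
  have h2 : ∑ i, p i * diagonalizer p U i l * diagonalizer p U i k =
      (∑ i, p i) * (diagonalizer p U k l * diagonalizer p U k k) := by
    rw [Finset.sum_mul]
    exact Finset.sum_congr rfl fun i _ => by rw [ck i k, cl i k]; ring
  rw [h2, hp.sum_eq_one, one_mul] at h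
  have h3 := diagonalizer_mul_of_eigenvalue_eq_zero hQ hirr hp hpos hU hdiag hk k k
  have h4 := diagonalizer_mul_of_eigenvalue_eq_zero hQ hirr hp hpos hU hdiag hl k k
  rcases mul_eq_zero.1 h with h | h
  · rw [h, zero_mul] at h4
    exact zero_ne_one h4
  · rw [h, zero_mul] at h3
    exact zero_ne_one h3

theorem sum_sq_mul_diagonalizer_pos (hpos : ∀ i, 0 < p i) (hU : Uᵀ * U = 1) (k : S) :
    0 < ∑ i, p i ^ 2 * diagonalizer p U i k ^ 2 := by
  have h := sum_mul_diagonalizer hpos hU k k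
  rw [if_pos rfl] at h
  refine lt_of_le_of_ne (Finset.sum_nonneg fun i _ => by positivity) fun h0 => ?_
  rw [eq_comm, Finset.sum_eq_zero_iff_of_nonneg fun i _ => by positivity] at h0
  have : ∑ i, p i * diagonalizer p U i k * diagonalizer p U i k = 0 := by
    refine Finset.sum_eq_zero fun i hi => ?_
    have h1 := h0 i hi
    have : diagonalizer p U i k = 0 := by
      simpa [(hpos i).ne'] using h1
    rw [this, mul_zero]
  rw [h] at this
  exact one_ne_zero this

end Spectral

section SpectralFin

variable {n : ℕ} {Q : Matrix (Fin (n + 1)) (Fin (n + 1)) ℝ} {p : Fin (n + 1) → ℝ}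
  {U : Matrix (Fin (n + 1)) (Fin (n + 1)) ℝ} {d : Fin n → ℝ}

theorem decay_rate_pos (hQ : IsGenerator Q) (hirr : IsIrreducible Q)
    (hp : IsStationary Q p) (hpos : ∀ i, 0 < p i) (hU : Uᵀ * U = 1)
    (hdiag : Uᵀ * symmetrizedGenerator Q p * U =
      diagonal (Fin.snoc (α := fun _ => ℝ) (fun j => -d j) 0)) (j : Fin n) : 0 < d j := by
  have h := eigenvalue_neg hQ hirr hp hpos hU hdiag (k := Fin.last n) (l := j.castSucc)
    (by simp) (Fin.castSucc_lt_last j).ne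
  simpa using h

/-- The eigenvalue 0 sits in the last slot; its exponential is 1 and its eigenvector ±1, so this
term is the stationary probability `p j`. -/
theorem transitionProb_eq_add_sum (hQ : IsGenerator Q) (hirr : IsIrreducible Q)
    (hp : IsStationary Q p) (hpos : ∀ i, 0 < p i) (hU : Uᵀ * U = 1)
    (hdiag : Uᵀ * symmetrizedGenerator Q p * U =
      diagonal (Fin.snoc (α := fun _ => ℝ) (fun j => -d j) 0)) (t : ℝ≥0)
    (i j : Fin (n + 1)) :
    transitionProb Q t i j = p j + ∑ k : Fin n, p j * diagonalizer p U i k.castSucc *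
      diagonalizer p U j k.castSucc * Real.exp (-d k * t) := by
  have h1 := diagonalizer_mul_of_eigenvalue_eq_zero hQ hirr hp hpos hU hdiag (k := Fin.last n)
    (by simp) i j
  rw [transitionProb_eq_sum hpos hU hdiag, Fin.sum_univ_castSucc, add_comm]
  simp [mul_assoc, h1]

theorem sum_mul_transitionProb (hQ : IsGenerator Q) (hirr : IsIrreducible Q)
    (hp : IsStationary Q p) (hpos : ∀ i, 0 < p i) (hU : Uᵀ * U = 1)
    (hdiag : Uᵀ * symmetrizedGenerator Q p * U =
      diagonal (Fin.snoc (α := fun _ => ℝ) (fun j => -d j) 0)) (t : ℝ≥0) :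
    ∑ i, p i * transitionProb Q t i i = ∑ i, p i ^ 2 + ∑ k : Fin n,
      (∑ i, p i ^ 2 * diagonalizer p U i k.castSucc ^ 2) * Real.exp (-d k * t) := by
  simp only [transitionProb_eq_add_sum hQ hirr hp hpos hU hdiag, mul_add, Finset.sum_add_distrib]
  congr 1
  · exact Finset.sum_congr rfl fun i _ => by ring
  · simp only [Finset.mul_sum, Finset.sum_mul]
    rw [Finset.sum_comm]
    exact Finset.sum_congr rfl fun i _ => Finset.sum_congr rfl fun k _ => by ring

theorem exists_abs_transitionProb_sub_le (hQ : IsGenerator Q) (hirr : IsIrreducible Q)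
    (hp : IsStationary Q p) (hpos : ∀ i, 0 < p i) (hU : Uᵀ * U = 1)
    (hdiag : Uᵀ * symmetrizedGenerator Q p * U =
      diagonal (Fin.snoc (α := fun _ => ℝ) (fun j => -d j) 0)) :
    ∃ C δ : ℝ, 0 ≤ C ∧ 0 < δ ∧ ∀ (t : ℝ≥0) i j,
      |transitionProb Q t i j - p j| ≤ C * Real.exp (-(δ * t)) := by
  have hd := decay_rate_pos hQ hirr hp hpos hU hdiag
  -- `δ` is the spectral gap. For a single state there is no nonzero eigenvalue and any positive
  -- number serves.
  obtain ⟨δ, hδ, hδd⟩ : ∃ δ : ℝ, 0 < δ ∧ ∀ k, δ ≤ d k := by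
    obtain h | h := isEmpty_or_nonempty (Fin n)
    · exact ⟨1, one_pos, fun k => (h.false k).elim⟩
    · obtain ⟨k, hk⟩ := Finite.exists_min d
      exact ⟨d k, hd k, hk⟩
  set c : Fin (n + 1) → Fin (n + 1) → Fin n → ℝ := fun i j k =>
    |p j * diagonalizer p U i k.castSucc * diagonalizer p U j k.castSucc| with hc
  refine ⟨∑ i, ∑ j, ∑ k, c i j k, δ, Finset.sum_nonneg fun i _ => Finset.sum_nonneg fun j _ =>
    Finset.sum_nonneg fun k _ => abs_nonneg _, hδ, fun t i j => ?_⟩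
  rw [transitionProb_eq_add_sum hQ hirr hp hpos hU hdiag, add_sub_cancel_left]
  have h1 : ∑ k, c i j k ≤ ∑ i, ∑ j, ∑ k, c i j k :=
    (Finset.single_le_sum (f := fun j => ∑ k, c i j k)
      (fun j _ => Finset.sum_nonneg fun k _ => abs_nonneg _) (Finset.mem_univ j)).trans
    (Finset.single_le_sum (f := fun i => ∑ j, ∑ k, c i j k)
      (fun i _ => Finset.sum_nonneg fun j _ => Finset.sum_nonneg fun k _ => abs_nonneg _)
      (Finset.mem_univ i))
  refine le_trans ?_ (mul_le_mul_of_nonneg_right h1 (Real.exp_pos _).le)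
  rw [Finset.sum_mul]
  refine (Finset.abs_sum_le_sum_abs _ _).trans (Finset.sum_le_sum fun k _ => ?_)
  rw [abs_mul, Real.abs_exp]
  refine mul_le_mul_of_nonneg_left (Real.exp_le_exp.2 ?_) (abs_nonneg _)
  have := mul_le_mul_of_nonneg_right (hδd k) t.2
  simp only [NNReal.val_eq_coe] at this
  linarith

/-- The weights `b` and the squared stationary probabilities add up to one. -/
theorem sum_sq_add_sum_eq_one (hQ : IsGenerator Q) (hirr : IsIrreducible Q)
    (hp : IsStationary Q p) (hpos : ∀ i, 0 < p i) (hU : Uᵀ * U = 1)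
    (hdiag : Uᵀ * symmetrizedGenerator Q p * U =
      diagonal (Fin.snoc (α := fun _ => ℝ) (fun j => -d j) 0)) :
    ∑ i, p i ^ 2 + ∑ k : Fin n, (∑ i, p i ^ 2 * diagonalizer p U i k.castSucc ^ 2) = 1 := by
  -- At time 0 the transition matrix is the identity.
  have h := sum_mul_transitionProb hQ hirr hp hpos hU hdiag 0
  simpa [transitionProb, hp.sum_eq_one, eq_comm] using h

end SpectralFin

end SampledCTMC

/-! ### Sample paths: the last sample and its location on a grid -/

namespace SampledCTMC

section Paths

variable {S : Type*} {Ω : Type*}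

/-- The time at which the counting process reached the value it has at time `t`. -/
noncomputable def lastJump (N : ℝ≥0 → Ω → ℕ) (t : ℝ≥0) (ω : Ω) : ℝ≥0 := sInf {s | N s ω = N t ω}

/-- The last jump of `N` before time `c` lies in `(a, b]`. -/
def lastJumpIn (N : ℝ≥0 → Ω → ℕ) (a b c : ℝ≥0) : Set Ω := {ω | N a ω < N b ω ∧ N b ω = N c ω}

/-- The source is in the same state at the times `a` and `b`. -/
def agree (X : ℝ≥0 → Ω → S) (a b : ℝ≥0) : Set Ω := {ω | X a ω = X b ω}

/-- There is a sample after time `u`, and the estimator based on it is correct at time `t`. -/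
def freshSince (X : ℝ≥0 → Ω → S) (N : ℝ≥0 → Ω → ℕ) (u t : ℝ≥0) : Set Ω :=
  {ω | N u ω < N t ω ∧ X (lastJump N t ω) ω = X t ω}

/-- The last sample before `u + M h` lies in the `k`-th cell of the grid of mesh `h` on
`[u, u + M h]`, and the source has the same state at the end of this cell and at `u + M h`. -/
def gridEvent (X : ℝ≥0 → Ω → S) (N : ℝ≥0 → Ω → ℕ) (u h : ℝ≥0) (M k : ℕ) : Set Ω :=
  agree X (u + (k + 1 : ℕ) * h) (u + M * h) ∩
    lastJumpIn N (u + k * h) (u + (k + 1 : ℕ) * h) (u + M * h)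

theorem lastJump_le (N : ℝ≥0 → Ω → ℕ) (t : ℝ≥0) (ω : Ω) : lastJump N t ω ≤ t :=
  csInf_le' rfl

variable [MeasurableSpace Ω] {P : Measure Ω}
  {r : ℝ≥0} {X : ℝ≥0 → Ω → S} {N : ℝ≥0 → Ω → ℕ} {x₀ : Ω → S}

namespace IsPoissonProcess

/-- The infimum is attained: by monotonicity `N` has its final value immediately to the right of it,
and right-continuity carries the value back. -/
theorem eval_lastJump (hN : IsPoissonProcess P r N) (t : ℝ≥0) (ω : Ω) :
    N (lastJump N t ω) ω = N t ω := by
  have hne : {s | N s ω = N t ω}.Nonempty := ⟨t, rfl⟩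
  have h1 : ∀ᶠ s in 𝓝[>] lastJump N t ω, N s ω = N t ω := by
    obtain h | h := (lastJump_le N t ω).eq_or_lt
    · filter_upwards [hN.right_continuous ω (lastJump N t ω)] with s hs
      rw [hs, h]
    · filter_upwards [Ioc_mem_nhdsGT h] with s hs
      obtain ⟨q, hq, hqs⟩ := exists_lt_of_csInf_lt hne hs.1
      exact le_antisymm (hN.mono ω hs.2) (hq.symm.le.trans (hN.mono ω hqs.le))
  obtain ⟨s, hs1, hs2⟩ := (h1.and (hN.right_continuous ω (lastJump N t ω))).exists
  exact hs2.symm.trans hs1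

theorem eval_eq_iff (hN : IsPoissonProcess P r N) {s t : ℝ≥0} (hst : s ≤ t) (ω : Ω) :
    N s ω = N t ω ↔ lastJump N t ω ≤ s := by
  refine ⟨fun h => csInf_le' h, fun h => ?_⟩
  exact le_antisymm (hN.mono ω hst) ((hN.eval_lastJump t ω).symm.le.trans (hN.mono ω h))

theorem eval_lt_iff (hN : IsPoissonProcess P r N) {s t : ℝ≥0} (hst : s ≤ t) (ω : Ω) :
    N s ω < N t ω ↔ s < lastJump N t ω := by
  rw [← not_le (a := lastJump N t ω), ← hN.eval_eq_iff hst, (hN.mono ω hst).lt_iff_ne]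

theorem isGreatest_lastJump (hN : IsPoissonProcess P r N) {t : ℝ≥0} {ω : Ω} (ht : 0 < N t ω) :
    IsGreatest {s | s ≤ t ∧ IsSamplingTime N ω s} (lastJump N t ω) := by
  refine ⟨⟨lastJump_le N t ω, ?_, fun q hq => ?_⟩, fun s hs => ?_⟩
  · rw [← hN.eval_lt_iff zero_le, hN.zero]
    exact ht
  · rw [hN.eval_lastJump, hN.eval_lt_iff (hq.le.trans (lastJump_le N t ω))]
    exact hq
  · by_contra! h
    have h1 := hs.2.2 _ h
    rw [hN.eval_lastJump] at h1
    exact h1.not_ge (hN.mono ω hs.1)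

theorem exists_isSamplingTime_iff (hN : IsPoissonProcess P r N) {t : ℝ≥0} {ω : Ω} :
    (∃ s ≤ t, IsSamplingTime N ω s) ↔ 0 < N t ω := by
  refine ⟨fun ⟨s, hs, h0, h1⟩ => ?_, fun h => ⟨_, (hN.isGreatest_lastJump h).1⟩⟩
  exact (Nat.zero_le _).trans_lt ((h1 0 h0).trans_le (hN.mono ω hs))

theorem estimator_eq [DecidableEq S] (hN : IsPoissonProcess P r N) (t : ℝ≥0) (ω : Ω) :
    estimator X N x₀ t ω = if 0 < N t ω then X (lastJump N t ω) ω else x₀ ω := by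
  classical
  rw [estimator]
  by_cases h : 0 < N t ω
  · rw [if_pos (hN.exists_isSamplingTime_iff.2 h), if_pos h, latestSamplingTime,
      (hN.isGreatest_lastJump h).csSup_eq]
  · rw [if_neg (hN.exists_isSamplingTime_iff.not.2 h), if_neg h]

/-- `lastJump` is the infimum of a level set of `N`, so it depends on the time only through the
current count. -/
theorem estimator_congr [DecidableEq S] (hN : IsPoissonProcess P r N) {s t : ℝ≥0} {ω : Ω}
    (h : N s ω = N t ω) : estimator X N x₀ s ω = estimator X N x₀ t ω := by
  rw [hN.estimator_eq, hN.estimator_eq, lastJump, lastJump, h]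

/-- If there is a sample in `(u, t]`, the freshness at time `t` depends only on the source and the
samples after time `u`. -/
theorem mem_freshSince_iff [DecidableEq S] (hN : IsPoissonProcess P r N) {u t : ℝ≥0} {ω : Ω}
    (h : N u ω < N t ω) :
    ω ∈ freshSince X N u t ↔ estimator X N x₀ t ω = X t ω := by
  rw [hN.estimator_eq, if_pos ((Nat.zero_le _).trans_lt h)]
  simp [freshSince, h]

theorem lastJumpIn_unique (hN : IsPoissonProcess P r N) {u h : ℝ≥0} {M k l : ℕ} {ω : Ω}
    (hk : ω ∈ lastJumpIn N (u + k * h) (u + (k + 1 : ℕ) * h) (u + M * h))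
    (hl : ω ∈ lastJumpIn N (u + l * h) (u + (l + 1 : ℕ) * h) (u + M * h)) : k = l := by
  have key : ∀ {k l : ℕ}, ω ∈ lastJumpIn N (u + k * h) (u + (k + 1 : ℕ) * h) (u + M * h) →
      ω ∈ lastJumpIn N (u + l * h) (u + (l + 1 : ℕ) * h) (u + M * h) → ¬ k < l := by
    intro k l hk hl hkl
    have h1 : u + (k + 1 : ℕ) * h ≤ u + l * h := by
      gcongr
      exact hkl
    have h2 := hN.mono ω h1
    have h3 := hk.2
    have h4 := hl.1
    have h5 := hl.2
    simp only at h2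
    omega
  exact le_antisymm (not_lt.1 (key hl hk)) (not_lt.1 (key hk hl))

theorem sum_indicator_gridEvent_of_mem (hN : IsPoissonProcess P r N) {u h : ℝ≥0} {M k : ℕ}
    {ω : Ω} (hkM : k < M)
    (hk : ω ∈ lastJumpIn N (u + k * h) (u + (k + 1 : ℕ) * h) (u + M * h)) :
    ∑ l ∈ Finset.range M, (gridEvent X N u h M l).indicator (fun _ => (1 : ℝ)) ω =
      (agree X (u + (k + 1 : ℕ) * h) (u + M * h)).indicator (fun _ => (1 : ℝ)) ω := by
  rw [Finset.sum_eq_single k]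
  · by_cases h1 : ω ∈ agree X (u + (k + 1 : ℕ) * h) (u + M * h)
    · rw [Set.indicator_of_mem h1, Set.indicator_of_mem]
      exact ⟨h1, hk⟩
    · rw [Set.indicator_of_notMem h1, Set.indicator_of_notMem fun h2 => h1 h2.1]
  · intro l _ hlk
    exact Set.indicator_of_notMem (fun h2 => hlk (hN.lastJumpIn_unique h2.2 hk)) _
  · intro h2
    exact (h2 (Finset.mem_range.2 hkM)).elim

theorem sum_indicator_gridEvent_le_one (hN : IsPoissonProcess P r N) (u h : ℝ≥0) (M : ℕ)
    (ω : Ω) :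
    ∑ l ∈ Finset.range M, (gridEvent X N u h M l).indicator (fun _ => (1 : ℝ)) ω ≤ 1 := by
  by_cases hk : ∃ k < M, ω ∈ lastJumpIn N (u + k * h) (u + (k + 1 : ℕ) * h) (u + M * h)
  · obtain ⟨k, hkM, hk⟩ := hk
    rw [hN.sum_indicator_gridEvent_of_mem hkM hk]
    exact Set.indicator_apply_le' (fun _ => le_rfl) (fun _ => zero_le_one)
  · rw [Finset.sum_eq_zero]
    · exact zero_le_one
    · intro l hl
      exact Set.indicator_of_notMem (fun h2 => hk ⟨l, Finset.mem_range.1 hl, h2.2⟩) _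

theorem exists_mem_lastJumpIn (hN : IsPoissonProcess P r N) {u h : ℝ≥0} {M : ℕ} {ω : Ω}
    (hω : N u ω < N (u + M * h) ω) :
    ∃ k < M, ω ∈ lastJumpIn N (u + k * h) (u + (k + 1 : ℕ) * h) (u + M * h) := by
  classical
  -- The required cell ends at the first grid point where the count has its terminal value; this is
  -- not the initial point because there is a jump.
  have hex : ∃ k : ℕ, N (u + k * h) ω = N (u + M * h) ω := ⟨M, rfl⟩
  have h0 : Nat.find hex ≠ 0 := by
    intro h0
    have h1 := Nat.find_spec hex
    rw [h0] at h1
    simp only [Nat.cast_zero, zero_mul, add_zero] at h1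
    exact hω.ne h1
  obtain ⟨k, hk⟩ := Nat.exists_eq_succ_of_ne_zero h0
  have hkM : k < M := by
    have : Nat.find hex ≤ M := Nat.find_min' hex rfl
    omega
  have h2 : N (u + (k + 1 : ℕ) * h) ω = N (u + M * h) ω := by
    rw [← Nat.succ_eq_add_one, ← hk]
    exact Nat.find_spec hex
  refine ⟨k, hkM, ?_, h2⟩
  rw [h2, (hN.mono ω ?_).lt_iff_ne]
  · exact Nat.find_min hex (by omega)
  · gcongr

/-- The grid approximation of the freshness converges as the mesh tends to zero. -/
theorem tendsto_sum_indicator_gridEvent (hN : IsPoissonProcess P r N)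
    (hX : ∀ ω t, ∀ᶠ s in 𝓝[>] t, X s ω = X t ω) {u t : ℝ≥0} (hut : u ≤ t) (ω : Ω) :
    Tendsto (fun m : ℕ => ∑ l ∈ Finset.range (m + 1),
      (gridEvent X N u ((t - u) / (m + 1 : ℕ)) (m + 1) l).indicator (fun _ => (1 : ℝ)) ω) atTop
      (𝓝 ((freshSince X N u t).indicator (fun _ => (1 : ℝ)) ω)) := by
  have hM : ∀ m : ℕ, u + (m + 1 : ℕ) * ((t - u) / (m + 1 : ℕ)) = t := by
    intro m
    rw [mul_div_cancel₀ _ (by positivity), add_tsub_cancel_of_le hut]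
  obtain h0 | h0 := (hN.mono ω hut).eq_or_lt
  · refine tendsto_const_nhds.congr fun m => ?_
    rw [Set.indicator_of_notMem fun h1 => h1.1.ne h0, Finset.sum_eq_zero]
    intro l hl
    refine Set.indicator_of_notMem (fun h1 => ?_) _
    have h2 := h1.2.1
    rw [h1.2.2, hM] at h2
    exact (h2.trans_le (h0.symm.le.trans (hN.mono ω le_self_add))).false
  · have hex : ∀ m : ℕ, ∃ k < m + 1, ω ∈ lastJumpIn N (u + k * ((t - u) / (m + 1 : ℕ)))
        (u + (k + 1 : ℕ) * ((t - u) / (m + 1 : ℕ)))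
        (u + (m + 1 : ℕ) * ((t - u) / (m + 1 : ℕ))) := fun m =>
      hN.exists_mem_lastJumpIn (by rw [hM]; exact h0)
    choose k hkm hk using hex
    -- `q m` is the right end of the cell containing the last jump, so it tends to the jump time
    -- from above. Left ends would be useless for right-continuous paths.
    set q : ℕ → ℝ≥0 := fun m => u + (k m + 1 : ℕ) * ((t - u) / (m + 1 : ℕ)) with hq
    have hqt : ∀ m, q m ≤ t := by
      intro m
      calc q m ≤ u + (m + 1 : ℕ) * ((t - u) / (m + 1 : ℕ)) := by
            have h1 : k m + 1 ≤ m + 1 := hkm m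
            simp only [hq]
            gcongr
        _ = t := hM m
    have hq1 : ∀ m, lastJump N t ω ≤ q m := by
      intro m
      rw [← hN.eval_eq_iff (hqt m)]
      have := (hk m).2
      rwa [hM] at this
    have hq2 : ∀ m, q m ≤ lastJump N t ω + (t - u) / (m + 1 : ℕ) := by
      intro m
      have h1 : N (u + k m * ((t - u) / (m + 1 : ℕ))) ω < N t ω := by
        have := (hk m).1
        rwa [(hk m).2, hM] at this
      have h2 : u + k m * ((t - u) / (m + 1 : ℕ)) ≤ t := by
        refine le_trans ?_ (hqt m)
        rw [hq]
        push_cast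
        gcongr
        exact le_self_add
      rw [hN.eval_lt_iff h2] at h1
      calc q m = u + k m * ((t - u) / (m + 1 : ℕ)) + (t - u) / (m + 1 : ℕ) := by
            rw [hq]; push_cast; ring
        _ ≤ _ := by gcongr
    have hlim : Tendsto q atTop (𝓝 (lastJump N t ω)) := by
      refine tendsto_of_tendsto_of_tendsto_of_le_of_le tendsto_const_nhds ?_ hq1 hq2
      have h1 : Tendsto (fun m : ℕ => (t - u) / ((m + 1 : ℕ) : ℝ≥0)) atTop (𝓝 0) :=
        (tendsto_const_div_atTop_nhds_zero_nat (t - u)).comp (tendsto_add_atTop_nat 1)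
      simpa using h1.const_add (lastJump N t ω)
    -- `q m` may coincide with the jump time, hence the neighbourhood filter that includes the point
    -- itself.
    have hXe : ∀ᶠ m in atTop, X (q m) ω = X (lastJump N t ω) ω := by
      have h1 : ∀ᶠ s in 𝓝[≥] (lastJump N t ω), X s ω = X (lastJump N t ω) ω := by
        rw [← Set.Ioi_union_left, nhdsWithin_union, eventually_sup]
        exact ⟨hX ω _, by simp [nhdsWithin_singleton]⟩
      exact (tendsto_nhdsWithin_iff.2 ⟨hlim, Eventually.of_forall hq1⟩).eventually h1
    refine tendsto_const_nhds.congr' ?_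
    filter_upwards [hXe] with m hm
    rw [hN.sum_indicator_gridEvent_of_mem (hkm m) (hk m), hM]
    have : ω ∈ freshSince X N u t ↔ ω ∈ agree X (q m) t := by
      simp [freshSince, agree, h0, hm]
    by_cases h : ω ∈ freshSince X N u t
    · rw [Set.indicator_of_mem h, Set.indicator_of_mem (this.1 h)]
    · rw [Set.indicator_of_notMem h, Set.indicator_of_notMem (this.not.1 h)]

end IsPoissonProcess

end Paths

end SampledCTMC

/-! ### Probabilities at finitely many deterministic times -/

namespace SampledCTMC

section Probabilities

variable {S : Type*} [Fintype S] [DecidableEq S] [MeasurableSpace S] [MeasurableSingletonClass S]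
  {Ω : Type*} [MeasurableSpace Ω] {P : Measure Ω} [IsProbabilityMeasure P] {Q : Matrix S S ℝ}
  {r : ℝ≥0} {X : ℝ≥0 → Ω → S} {N : ℝ≥0 → Ω → ℕ} {x₀ : Ω → S}

namespace IsPoissonProcess

theorem measureReal_increment_eq_zero (hN : IsPoissonProcess P r N) {s t : ℝ≥0} (hst : s ≤ t) :
    P.real {ω | N t ω - N s ω = 0} = Real.exp (-(r * (t - s))) := by
  rw [(hN.law_increment s t hst).measureReal_eq (p := fun x => x = 0) (measurableSet_singleton _)]
  have := poissonMeasure_real_singleton (r * (t - s)) 0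
  rw [Set.ofPred_eq_eq_singleton, this]
  simp [NNReal.coe_sub hst]

theorem measureReal_increment_ne_zero (hN : IsPoissonProcess P r N) {s t : ℝ≥0} (hst : s ≤ t) :
    P.real {ω | N t ω - N s ω ≠ 0} = 1 - Real.exp (-(r * (t - s))) := by
  have hm : MeasurableSet {ω | N t ω - N s ω = 0} :=
    measurableSet_eq_fun ((hN.measurable t).sub (hN.measurable s)) measurable_const
  rw [← hN.measureReal_increment_eq_zero hst, ← probReal_compl_eq_one_sub hm]
  rfl

theorem measureReal_eval_eq (hN : IsPoissonProcess P r N) {s t : ℝ≥0} (hst : s ≤ t) :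
    P.real {ω | N s ω = N t ω} = Real.exp (-(r * (t - s))) := by
  rw [← hN.measureReal_increment_eq_zero hst]
  congr 1
  ext ω
  have := hN.mono ω hst
  simp only at this
  simp only [Set.mem_ofPred_eq]
  omega

theorem lastJumpIn_eq (hN : IsPoissonProcess P r N) {a b c : ℝ≥0} (hab : a ≤ b) (hbc : b ≤ c) :
    lastJumpIn N a b c = {ω | N b ω - N a ω ≠ 0} ∩ {ω | N c ω - N b ω = 0} := by
  ext ω
  have h1 := hN.mono ω hab
  have h2 := hN.mono ω hbc
  simp only at h1 h2
  simp only [lastJumpIn, Set.mem_inter_iff, Set.mem_ofPred_eq]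
  omega

theorem measureReal_lastJumpIn (hN : IsPoissonProcess P r N) {a b c : ℝ≥0} (hab : a ≤ b)
    (hbc : b ≤ c) :
    P.real (lastJumpIn N a b c) =
      (1 - Real.exp (-(r * (b - a)))) * Real.exp (-(r * (c - b))) := by
  have hτ : Monotone ![a, b, c] := by
    rw [Fin.monotone_iff_le_succ]
    intro i
    fin_cases i <;> simpa
  have h := (hN.indep_increments 2 _ hτ).measure_inter_preimage_eq_mul {0, 1}
    (sets := ![{0}ᶜ, {0}]) (fun _ _ => MeasurableSet.of_discrete)
  rw [hN.lastJumpIn_eq hab hbc, ← hN.measureReal_increment_ne_zero hab,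
    ← hN.measureReal_increment_eq_zero hbc, measureReal_def, measureReal_def, measureReal_def,
    ← ENNReal.toReal_mul]
  congr 1
  convert h using 2
  · simp [Set.preimage, Set.compl_def]
  · simp [Set.preimage, Set.compl_def]

theorem measureReal_lastJumpIn_inter (hN : IsPoissonProcess P r N) {a b s c e t : ℝ≥0}
    (hab : a ≤ b) (hbs : b ≤ s) (hsc : s ≤ c) (hce : c ≤ e) (het : e ≤ t) :
    P.real (lastJumpIn N a b s ∩ lastJumpIn N c e t) =
      P.real (lastJumpIn N a b s) * P.real (lastJumpIn N c e t) := by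
  have hτ : Monotone ![a, b, s, c, e, t] := by
    rw [Fin.monotone_iff_le_succ]
    intro i
    fin_cases i <;> simpa
  -- Five successive increments; index 2, the gap between the two intervals, is left unconstrained.
  have h := (hN.indep_increments 5 _ hτ).measure_inter_preimage_eq_mul {0, 1, 3, 4}
    (sets := ![{0}ᶜ, {0}, Set.univ, {0}ᶜ, {0}]) (fun _ _ => MeasurableSet.of_discrete)
  rw [hN.measureReal_lastJumpIn hab hbs, hN.measureReal_lastJumpIn hce het,
    hN.lastJumpIn_eq hab hbs, hN.lastJumpIn_eq hce het, ← hN.measureReal_increment_ne_zero hab,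
    ← hN.measureReal_increment_eq_zero hbs, ← hN.measureReal_increment_ne_zero hce,
    ← hN.measureReal_increment_eq_zero het]
  simp only [measureReal_def, ← ENNReal.toReal_mul]
  congr 1
  convert h using 1
  · congr 1
    ext ω
    simp [and_assoc]
  · simp [Set.preimage, mul_assoc, Finset.prod_insert, Set.compl_def]

theorem measurableSet_lastJumpIn (hN : IsPoissonProcess P r N) (a b c : ℝ≥0) :
    MeasurableSet (lastJumpIn N a b c) :=
  (measurableSet_lt (hN.measurable a) (hN.measurable b)).inter
    (measurableSet_eq_fun (hN.measurable b) (hN.measurable c))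

end IsPoissonProcess

namespace IsCTMC

theorem measurableSet_agree (hX : IsCTMC P Q X) (a b : ℝ≥0) : MeasurableSet (agree X a b) :=
  measurableSet_eq_fun (hX.measurable a) (hX.measurable b)

/-- The event is split by the states at `a` and `b`, and the Markov property is used from `s` to `b`
and from `b` to `t`. The law at `a` and `s` is left unexpanded: only its total mass is needed later,
so the initial law may be arbitrary. -/
theorem measureReal_agree_inter (hX : IsCTMC P Q X) {a s b t : ℝ≥0} (has : a ≤ s) (hsb : s ≤ b)
    (hbt : b ≤ t) :
    P.real (agree X a s ∩ agree X b t) = ∑ i, P.real {ω | X a ω = i ∧ X s ω = i} *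
      ∑ j, transitionProb Q (b - s) i j * transitionProb Q (t - b) j j := by
  have key : ∀ i j, P.real {ω | (X a ω = i ∧ X s ω = i) ∧ X b ω = j ∧ X t ω = j} =
      P.real {ω | X a ω = i ∧ X s ω = i} *
        (transitionProb Q (b - s) i j * transitionProb Q (t - b) j j) := by
    intro i j
    have hτ : Monotone ![a, s] := by
      rw [Fin.monotone_iff_le_succ]
      intro i
      fin_cases i
      simpa
    have hτ' : Monotone ![a, s, b] := by
      rw [Fin.monotone_iff_le_succ]
      intro i
      fin_cases i <;> simpa
    have h1 := hX.markov 1 ![a, s] hτ ![i, i] b (by simpa using hsb) j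
    have h2 := hX.markov 2 ![a, s, b] hτ' ![i, i, j] t (by simpa [Fin.last] using hbt) j
    have e1 : (![a, s] : Fin 2 → ℝ≥0) (Fin.last 1) = s := rfl
    have e2 : (![a, s, b] : Fin 3 → ℝ≥0) (Fin.last 2) = b := rfl
    have e3 : (![i, i] : Fin 2 → S) (Fin.last 1) = i := rfl
    have e4 : (![i, i, j] : Fin 3 → S) (Fin.last 2) = j := rfl
    rw [e1, e3] at h1
    rw [e2, e4] at h2
    simp only [Fin.forall_fin_succ, Matrix.cons_val_zero,
      Matrix.cons_val_succ, IsEmpty.forall_iff, and_true] at h1 h2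
    rw [← mul_assoc, ← h1]
    simp only [and_assoc] at h2 ⊢
    exact h2
  have hm : ∀ i j, MeasurableSet {ω | (X a ω = i ∧ X s ω = i) ∧ X b ω = j ∧ X t ω = j} := by
    intro i j
    have h (q : ℝ≥0) (k : S) : MeasurableSet {ω | X q ω = k} :=
      hX.measurable q (measurableSet_singleton k)
    exact ((h a i).inter (h s i)).inter ((h b j).inter (h t j))
  have hU : agree X a s ∩ agree X b t = ⋃ x ∈ (Finset.univ : Finset (S × S)),
      {ω | (X a ω = x.1 ∧ X s ω = x.1) ∧ X b ω = x.2 ∧ X t ω = x.2} := by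
    ext ω
    simp only [agree, Set.mem_inter_iff, Set.mem_ofPred_eq, Finset.mem_univ, Set.iUnion_true,
      Set.mem_iUnion, Prod.exists]
    constructor
    · rintro ⟨h1, h2⟩
      exact ⟨X a ω, X b ω, ⟨rfl, h1.symm⟩, rfl, h2.symm⟩
    · rintro ⟨i, j, ⟨h1, h2⟩, h3, h4⟩
      exact ⟨h1.trans h2.symm, h3.trans h4.symm⟩
  rw [hU, measureReal_biUnion_finset _ (fun x _ => hm x.1 x.2), Fintype.sum_prod_type]
  · simp only [key, Finset.mul_sum]
  · rintro ⟨i, j⟩ _ ⟨k, l⟩ _ hne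
    refine Set.disjoint_left.2 fun ω h1 h2 => hne ?_
    exact Prod.ext (h1.1.1.symm.trans h2.1.1) (h1.2.1.symm.trans h2.2.1)

theorem measureReal_agree (hX : IsCTMC P Q X) (a s : ℝ≥0) :
    P.real (agree X a s) = ∑ i, P.real {ω | X a ω = i ∧ X s ω = i} := by
  have hU : agree X a s = ⋃ i ∈ (Finset.univ : Finset S), {ω | X a ω = i ∧ X s ω = i} := by
    ext ω
    simp [agree, eq_comm]
  have h (q : ℝ≥0) (k : S) : MeasurableSet {ω | X q ω = k} :=
    hX.measurable q (measurableSet_singleton k)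
  rw [hU, measureReal_biUnion_finset ?_ (fun i _ => ?_)]
  · rintro i _ k _ hne
    exact Set.disjoint_left.2 fun ω h1 h2 => hne (h1.1.symm.trans h2.1)
  · exact (h a i).inter (h s i)

/-- The agreement of `X` at two late times is almost independent of its agreement at two early
times. -/
theorem abs_measureReal_agree_inter_sub_le (hX : IsCTMC P Q X) {p : S → ℝ} {C δ : ℝ} (hC : 0 ≤ C)
    (hδ : 0 ≤ δ) (hp : ∀ j, |p j| ≤ 1)
    (hdecay : ∀ (t : ℝ≥0) i j, |transitionProb Q t i j - p j| ≤ C * Real.exp (-(δ * t)))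
    {a s b t : ℝ≥0} (has : a ≤ s) (hsb : s ≤ b) (hbt : b ≤ t) :
    |P.real (agree X a s ∩ agree X b t) -
        P.real (agree X a s) * ∑ j, p j * transitionProb Q (t - b) j j| ≤
      Fintype.card S * C * (C + 1) * Real.exp (-(δ * (b - s))) := by
  -- The bound `C + 1` follows from the decay estimate and `|p j| ≤ 1` alone.
  have hbound : ∀ j, |transitionProb Q (t - b) j j| ≤ C + 1 := by
    intro j
    have h1 := hdecay (t - b) j j
    have h2 : Real.exp (-(δ * (t - b : ℝ≥0))) ≤ 1 :=
      Real.exp_le_one_iff.2 (neg_nonpos.2 (mul_nonneg hδ (NNReal.coe_nonneg _)))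
    have h3 := mul_le_mul_of_nonneg_left h2 hC
    have h4 := abs_sub_abs_le_abs_sub (transitionProb Q (t - b) j j) (p j)
    linarith [hp j]
  rw [hX.measureReal_agree_inter has hsb hbt, hX.measureReal_agree, Finset.sum_mul,
    ← Finset.sum_sub_distrib]
  simp only [← mul_sub, ← Finset.sum_sub_distrib, ← sub_mul]
  have h1 : ∀ i, |∑ j, (transitionProb Q (b - s) i j - p j) * transitionProb Q (t - b) j j| ≤
      Fintype.card S * C * (C + 1) * Real.exp (-(δ * (b - s))) := by
    intro i
    refine (Finset.abs_sum_le_sum_abs _ _).trans ?_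
    calc ∑ j, |(transitionProb Q (b - s) i j - p j) * transitionProb Q (t - b) j j|
        ≤ ∑ _j : S, C * Real.exp (-(δ * (b - s))) * (C + 1) := by
          refine Finset.sum_le_sum fun j _ => ?_
          rw [abs_mul]
          have := hdecay (b - s) i j
          rw [NNReal.coe_sub hsb] at this
          exact mul_le_mul this (hbound j) (abs_nonneg _)
            (mul_nonneg hC (Real.exp_pos _).le)
      _ = _ := by
          rw [Finset.sum_const, nsmul_eq_mul, Finset.card_univ]
          ring
  calc |∑ i, P.real {ω | X a ω = i ∧ X s ω = i} *
          ∑ j, (transitionProb Q (b - s) i j - p j) * transitionProb Q (t - b) j j|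
      ≤ ∑ i, P.real {ω | X a ω = i ∧ X s ω = i} *
          (Fintype.card S * C * (C + 1) * Real.exp (-(δ * (b - s)))) := by
        refine (Finset.abs_sum_le_sum_abs _ _).trans (Finset.sum_le_sum fun i _ => ?_)
        rw [abs_mul, abs_of_nonneg measureReal_nonneg]
        exact mul_le_mul_of_nonneg_left (h1 i) measureReal_nonneg
    _ = P.real (agree X a s) * (Fintype.card S * C * (C + 1) * Real.exp (-(δ * (b - s)))) := by
        rw [← Finset.sum_mul, hX.measureReal_agree]
    _ ≤ _ := mul_le_of_le_one_left (by positivity) measureReal_le_one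

end IsCTMC

theorem IsPoissonSampled.measureReal_inter (h : IsPoissonSampled P Q r X N x₀)
    {A : Set (ℝ≥0 → S)} {B : Set (ℝ≥0 → ℕ)} (hA : MeasurableSet A) (hB : MeasurableSet B) :
    P.real ({ω | (fun t => X t ω) ∈ A} ∩ {ω | (fun t => N t ω) ∈ B}) =
      P.real {ω | (fun t => X t ω) ∈ A} * P.real {ω | (fun t => N t ω) ∈ B} := by
  simp only [measureReal_def, ← ENNReal.toReal_mul]
  congr 1
  exact h.indep.measure_inter_preimage_eq_mul _ _ hA hB

end Probabilities

end SampledCTMC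

/-! ### Riemann sums and mesh-independent estimates on the grid -/

namespace SampledCTMC

section GeometricSums

theorem tendsto_one_sub_exp_div {c L : ℝ} (hL : 0 < L) :
    Tendsto (fun m : ℕ => (1 - Real.exp (-(c * (L / (m + 1 : ℕ))))) / (L / (m + 1 : ℕ))) atTop
      (𝓝 c) := by
  have hd : HasDerivAt (fun x : ℝ => 1 - Real.exp (-(c * x))) c 0 := by
    have h1 : HasDerivAt (fun x : ℝ => -(c * x)) (-(c * 1)) 0 :=
      ((hasDerivAt_id (0 : ℝ)).const_mul c).neg
    have h2 := (h1.exp).const_sub 1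
    simpa using h2
  have h3 := hasDerivAt_iff_tendsto_slope.1 hd
  have h4 : Tendsto (fun m : ℕ => L / ((m + 1 : ℕ) : ℝ)) atTop (𝓝[≠] 0) := by
    refine tendsto_nhdsWithin_iff.2 ⟨?_, Eventually.of_forall fun m => ?_⟩
    · exact (tendsto_const_div_atTop_nhds_zero_nat L).comp (tendsto_add_atTop_nat 1)
    · exact (div_pos hL (by positivity)).ne'
  refine (h3.comp h4).congr fun m => ?_
  simp [slope_def_field]

/-- A discrete form of ∫₀ᴸ r exp(-(r+θ)v) dv. With h the mesh, the sum is geometric with ratio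
exp(-(r+θ)h), and (1 - exp(-rh)) / (1 - exp(-(r+θ)h)) tends to r/(r+θ). -/
theorem tendsto_geometric_riemann_sum {r θ L : ℝ} (hr : 0 < r) (hθ : 0 ≤ θ) (hL : 0 ≤ L) :
    Tendsto (fun m : ℕ => ∑ l ∈ Finset.range (m + 1),
      (1 - Real.exp (-(r * (L / (m + 1 : ℕ))))) * Real.exp (-(r * (l * (L / (m + 1 : ℕ))))) *
        Real.exp (-θ * (l * (L / (m + 1 : ℕ))))) atTop
      (𝓝 (r / (r + θ) * (1 - Real.exp (-((r + θ) * L))))) := by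
  obtain rfl | hL := hL.eq_or_lt
  · simp
  have ha : 0 < r + θ := by linarith
  have h1 := ((tendsto_one_sub_exp_div (c := r) hL).div (tendsto_one_sub_exp_div (c := r + θ) hL)
    ha.ne').mul_const (1 - Real.exp (-((r + θ) * L)))
  refine h1.congr fun m => ?_
  have hh : 0 < L / ((m + 1 : ℕ) : ℝ) := div_pos hL (by positivity)
  set h : ℝ := L / ((m + 1 : ℕ) : ℝ) with hdef
  have hmh : ((m + 1 : ℕ) : ℝ) * h = L := mul_div_cancel₀ _ (by positivity)
  have hne : Real.exp (-((r + θ) * h)) < 1 := by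
    rw [Real.exp_lt_one_iff]
    have := mul_pos ha hh
    linarith
  have h2 : ∑ l ∈ Finset.range (m + 1), (1 - Real.exp (-(r * h))) * Real.exp (-(r * (l * h))) *
      Real.exp (-θ * (l * h)) = (1 - Real.exp (-(r * h))) *
        ∑ l ∈ Finset.range (m + 1), Real.exp (-((r + θ) * h)) ^ l := by
    rw [Finset.mul_sum]
    refine Finset.sum_congr rfl fun l _ => ?_
    rw [mul_assoc, ← Real.exp_add, ← Real.exp_nat_mul]
    congr 2
    ring
  have h3 : Real.exp (-((r + θ) * L)) = Real.exp (-((r + θ) * h)) ^ (m + 1) := by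
    rw [← Real.exp_nat_mul, ← hmh]
    congr 1
    ring
  rw [h2, geom_sum_eq hne.ne, h3]
  change (1 - Real.exp (-(r * h))) / h / ((1 - Real.exp (-((r + θ) * h))) / h) * _ = _
  generalize Real.exp (-((r + θ) * h)) = x at hne ⊢
  have h4 : 1 - x ≠ 0 := by linarith
  have h5 : x - 1 ≠ 0 := by linarith
  field_simp
  ring

end GeometricSums

section GridEstimates

variable {S : Type*} [Fintype S] [DecidableEq S] [MeasurableSpace S] [MeasurableSingletonClass S]
  {Ω : Type*} [MeasurableSpace Ω] {P : Measure Ω} [IsProbabilityMeasure P] {Q : Matrix S S ℝ}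
  {r : ℝ≥0} {X : ℝ≥0 → Ω → S} {N : ℝ≥0 → Ω → ℕ} {x₀ : Ω → S} {p : S → ℝ}

theorem grid_le (u h : ℝ≥0) {k l : ℕ} (hkl : k ≤ l) : u + k * h ≤ u + l * h :=
  add_le_add le_rfl (mul_le_mul_of_nonneg_right (Nat.cast_le.2 hkl) zero_le)

/-- The probability that the source, in equilibrium, is in the same state after time `v`. -/
noncomputable def returnProb (Q : Matrix S S ℝ) (p : S → ℝ) (v : ℝ≥0) : ℝ :=
  ∑ j, p j * transitionProb Q v j j

/-- The grid approximation of the stationary probability that there is a sample in an interval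
of length `M h` and that the estimate at its end is correct. -/
noncomputable def gridFreshness (Q : Matrix S S ℝ) (p : S → ℝ) (r h : ℝ≥0) (M : ℕ) : ℝ :=
  ∑ l ∈ Finset.range M,
    (1 - Real.exp (-(r * h))) * Real.exp (-(r * (l * h))) * returnProb Q p (l * h)

/-- `p` is a vector of limiting probabilities for `Q`, approached at an exponential rate. -/
structure IsMixing (Q : Matrix S S ℝ) (p : S → ℝ) (C δ : ℝ) : Prop where
  const_nonneg : 0 ≤ C
  rate_nonneg : 0 ≤ δ
  abs_le_one : ∀ j, |p j| ≤ 1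
  decay : ∀ (t : ℝ≥0) i j, |transitionProb Q t i j - p j| ≤ C * Real.exp (-(δ * t))

variable {C δ : ℝ}

namespace IsPoissonSampled

theorem measurableSet_gridEvent (hS : IsPoissonSampled P Q r X N x₀) (u h : ℝ≥0) (M k : ℕ) :
    MeasurableSet (gridEvent X N u h M k) :=
  (hS.chain.measurableSet_agree _ _).inter (hS.poisson.measurableSet_lastJumpIn _ _ _)

theorem measureReal_agree_inter_lastJumpIn (hS : IsPoissonSampled P Q r X N x₀)
    (a b c e s : ℝ≥0) :
    P.real (agree X a b ∩ lastJumpIn N c e s) =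
      P.real (agree X a b) * P.real (lastJumpIn N c e s) :=
  hS.measureReal_inter (A := {x | x a = x b}) (B := {y | y c < y e ∧ y e = y s})
    (measurableSet_eq_fun (measurable_pi_apply a) (measurable_pi_apply b))
    ((measurableSet_lt (measurable_pi_apply c) (measurable_pi_apply e)).inter
      (measurableSet_eq_fun (measurable_pi_apply e) (measurable_pi_apply s)))

theorem measureReal_agree_inter_lastJumpIn_inter (hS : IsPoissonSampled P Q r X N x₀)
    {a b s c e t : ℝ≥0} (hab : a ≤ b) (hbs : b ≤ s) (hsc : s ≤ c) (hce : c ≤ e) (het : e ≤ t) :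
    P.real ((agree X b s ∩ lastJumpIn N a b s) ∩ (agree X e t ∩ lastJumpIn N c e t)) =
      P.real (agree X b s ∩ agree X e t) *
        (P.real (lastJumpIn N a b s) * P.real (lastJumpIn N c e t)) := by
  rw [← hS.poisson.measureReal_lastJumpIn_inter hab hbs hsc hce het, Set.inter_inter_inter_comm]
  exact hS.measureReal_inter (A := {x | x b = x s} ∩ {x | x e = x t})
    (B := {y | y a < y b ∧ y b = y s} ∩ {y | y c < y e ∧ y e = y t})
    ((measurableSet_eq_fun (measurable_pi_apply b) (measurable_pi_apply s)).inter
      (measurableSet_eq_fun (measurable_pi_apply e) (measurable_pi_apply t)))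
    (((measurableSet_lt (measurable_pi_apply a) (measurable_pi_apply b)).inter
      (measurableSet_eq_fun (measurable_pi_apply b) (measurable_pi_apply s))).inter
      ((measurableSet_lt (measurable_pi_apply c) (measurable_pi_apply e)).inter
      (measurableSet_eq_fun (measurable_pi_apply e) (measurable_pi_apply t))))

/-- At most one cell contains the last jump. Since every cell contributes an error weighted by its
probability, this keeps the total error independent of the mesh. -/
theorem sum_measureReal_lastJumpIn_le (hS : IsPoissonSampled P Q r X N x₀) (u h : ℝ≥0) (M : ℕ) :
    ∑ k ∈ Finset.range M,
      P.real (lastJumpIn N (u + k * h) (u + (k + 1 : ℕ) * h) (u + M * h)) ≤ 1 := by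
  rw [← measureReal_biUnion_finset]
  · exact measureReal_le_one
  · intro k _ l _ hkl
    exact Set.disjoint_left.2 fun ω h1 h2 => hkl (hS.poisson.lastJumpIn_unique h1 h2)
  · exact fun k _ => hS.poisson.measurableSet_lastJumpIn _ _ _

theorem sum_measureReal_lastJumpIn_mul (hS : IsPoissonSampled P Q r X N x₀) (u h : ℝ≥0) (M : ℕ) :
    ∑ k ∈ Finset.range M,
      P.real (lastJumpIn N (u + k * h) (u + (k + 1 : ℕ) * h) (u + M * h)) *
        returnProb Q p (u + M * h - (u + (k + 1 : ℕ) * h)) = gridFreshness Q p r h M := by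
  symm
  -- The grid freshness is indexed by the age of the sample: the right end of cell `k` lies `M - 1 -
  -- k` steps before the final time.
  rw [gridFreshness, ← Finset.sum_range_reflect]
  refine Finset.sum_congr rfl fun k hk => ?_
  rw [Finset.mem_range] at hk
  obtain ⟨q, rfl⟩ : ∃ q, M = q + (k + 1) := ⟨M - (k + 1), by omega⟩
  have hq : q + (k + 1) - 1 - k = q := by omega
  have h1 : u + k * h ≤ u + (k + 1 : ℕ) * h := by
    gcongr
    exact Nat.le_succ k
  have h2 : u + (k + 1 : ℕ) * h ≤ u + (q + (k + 1) : ℕ) * h :=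
    add_le_add le_rfl (mul_le_mul_of_nonneg_right (Nat.cast_le.2 (by omega)) zero_le)
  have h3 : u + (q + (k + 1) : ℕ) * h - (u + (k + 1 : ℕ) * h) = q * h := by
    rw [← NNReal.coe_inj, NNReal.coe_sub h2]
    push_cast
    ring
  rw [hS.poisson.measureReal_lastJumpIn h1 h2, h3, hq]
  congr 3
  · push_cast
    ring_nf
  · push_cast
    ring_nf


/-- By independence of source and sampling, the mixing estimate for the source is multiplied by the
two cell probabilities. The source actually mixes during `e - s`; the smaller `c - s` is easier to
bound uniformly over cells. -/
theorem abs_measureReal_inter_sub_le (hS : IsPoissonSampled P Q r X N x₀)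
    (hQ : IsMixing Q p C δ) {a b s c e t : ℝ≥0} (hab : a ≤ b) (hbs : b ≤ s) (hsc : s ≤ c)
    (hce : c ≤ e) (het : e ≤ t) :
    |P.real ((agree X b s ∩ lastJumpIn N a b s) ∩ (agree X e t ∩ lastJumpIn N c e t)) -
        P.real (agree X b s ∩ lastJumpIn N a b s) *
          (P.real (lastJumpIn N c e t) * returnProb Q p (t - e))| ≤
      P.real (lastJumpIn N a b s) * (P.real (lastJumpIn N c e t) *
        (Fintype.card S * C * (C + 1) * Real.exp (-(δ * (c - s))))) := by
  have h1 := hS.chain.abs_measureReal_agree_inter_sub_le hQ.const_nonneg hQ.rate_nonneg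
    hQ.abs_le_one hQ.decay hbs (hsc.trans hce) het
  have h2 : Real.exp (-(δ * (e - s))) ≤ Real.exp (-(δ * (c - s))) := by
    rw [Real.exp_le_exp, neg_le_neg_iff]
    exact mul_le_mul_of_nonneg_left (sub_le_sub_right (NNReal.coe_le_coe.2 hce) _)
      hQ.rate_nonneg
  have h3 : 0 ≤ Fintype.card S * C * (C + 1) := by
    have := hQ.const_nonneg
    positivity
  have h4 := h1.trans (mul_le_mul_of_nonneg_left h2 h3)
  rw [hS.measureReal_agree_inter_lastJumpIn_inter hab hbs hsc hce het,
    hS.measureReal_agree_inter_lastJumpIn]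
  have h5 := mul_le_mul_of_nonneg_left h4 (mul_nonneg
    (measureReal_nonneg (μ := P) (s := lastJumpIn N a b s))
    (measureReal_nonneg (μ := P) (s := lastJumpIn N c e t)))
  rw [← abs_of_nonneg (mul_nonneg
    (measureReal_nonneg (μ := P) (s := lastJumpIn N a b s))
    (measureReal_nonneg (μ := P) (s := lastJumpIn N c e t))), ← abs_mul,
    abs_of_nonneg (mul_nonneg
    (measureReal_nonneg (μ := P) (s := lastJumpIn N a b s))
    (measureReal_nonneg (μ := P) (s := lastJumpIn N c e t)))] at h5
  rw [← mul_assoc (P.real (lastJumpIn N a b s))]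
  refine le_trans (le_of_eq ?_) h5
  congr 1
  rw [returnProb]
  ring

theorem abs_measureReal_sub_le (hS : IsPoissonSampled P Q r X N x₀)
    (hQ : IsMixing Q p C δ) {c e t : ℝ≥0} (hce : c ≤ e) (het : e ≤ t) :
    |P.real (agree X e t ∩ lastJumpIn N c e t) -
        P.real (lastJumpIn N c e t) * returnProb Q p (t - e)| ≤
      P.real (lastJumpIn N c e t) *
        (Fintype.card S * C * (C + 1) * Real.exp (-(δ * c))) := by
  -- The one-interval estimate is the two-interval one with the trivial first pair of times `0, 0`,
  -- where agreement is certain.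
  have h1 := hS.chain.abs_measureReal_agree_inter_sub_le hQ.const_nonneg hQ.rate_nonneg
    hQ.abs_le_one hQ.decay (le_refl 0) zero_le het
  have h0 : agree X 0 0 = Set.univ := Set.eq_univ_of_forall fun _ => rfl
  rw [h0, Set.univ_inter, probReal_univ, one_mul, NNReal.coe_zero, sub_zero] at h1
  have h2 : Real.exp (-(δ * e)) ≤ Real.exp (-(δ * c)) := by
    rw [Real.exp_le_exp, neg_le_neg_iff]
    exact mul_le_mul_of_nonneg_left (NNReal.coe_le_coe.2 hce) hQ.rate_nonneg
  have h3 : 0 ≤ Fintype.card S * C * (C + 1) := by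
    have := hQ.const_nonneg
    positivity
  have h4 := h1.trans (mul_le_mul_of_nonneg_left h2 h3)
  rw [hS.measureReal_agree_inter_lastJumpIn, mul_comm (P.real (agree X e t)), ← mul_sub, abs_mul,
    abs_of_nonneg measureReal_nonneg]
  exact mul_le_mul_of_nonneg_left h4 measureReal_nonneg

theorem integral_sum_indicator_gridEvent (hS : IsPoissonSampled P Q r X N x₀) (u h : ℝ≥0)
    (M : ℕ) :
    ∫ ω, ∑ l ∈ Finset.range M, (gridEvent X N u h M l).indicator (fun _ => (1 : ℝ)) ω ∂P =
      ∑ l ∈ Finset.range M, P.real (gridEvent X N u h M l) := by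
  rw [integral_finsetSum]
  · exact Finset.sum_congr rfl fun l _ =>
      integral_indicator_one (hS.measurableSet_gridEvent u h M l)
  · exact fun l _ => (integrable_const (1 : ℝ)).indicator (hS.measurableSet_gridEvent u h M l)

theorem integral_sum_indicator_gridEvent_mul (hS : IsPoissonSampled P Q r X N x₀)
    (u h u' h' : ℝ≥0) (M : ℕ) :
    ∫ ω, (∑ k ∈ Finset.range M, (gridEvent X N u h M k).indicator (fun _ => (1 : ℝ)) ω) *
        (∑ l ∈ Finset.range M, (gridEvent X N u' h' M l).indicator (fun _ => (1 : ℝ)) ω) ∂P =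
      ∑ k ∈ Finset.range M, ∑ l ∈ Finset.range M,
        P.real (gridEvent X N u h M k ∩ gridEvent X N u' h' M l) := by
  have hm k l := (hS.measurableSet_gridEvent u h M k).inter (hS.measurableSet_gridEvent u' h' M l)
  have h1 : ∀ ω, (∑ k ∈ Finset.range M, (gridEvent X N u h M k).indicator (fun _ => (1 : ℝ)) ω) *
        (∑ l ∈ Finset.range M, (gridEvent X N u' h' M l).indicator (fun _ => (1 : ℝ)) ω) =
      ∑ k ∈ Finset.range M, ∑ l ∈ Finset.range M,
        (gridEvent X N u h M k ∩ gridEvent X N u' h' M l).indicator (fun _ => (1 : ℝ)) ω := by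
    intro ω
    rw [Finset.sum_mul_sum]
    refine Finset.sum_congr rfl fun k _ => Finset.sum_congr rfl fun l _ => ?_
    simpa using (Set.inter_indicator_mul (s := gridEvent X N u h M k)
      (t := gridEvent X N u' h' M l) (fun _ => (1 : ℝ)) (fun _ => 1) ω).symm
  simp only [h1]
  rw [integral_finsetSum]
  · refine Finset.sum_congr rfl fun k _ => ?_
    rw [integral_finsetSum]
    · exact Finset.sum_congr rfl fun l _ => integral_indicator_one (hm k l)
    · exact fun l _ => (integrable_const (1 : ℝ)).indicator (hm k l)
  · exact fun k _ => integrable_finsetSum _ fun l _ =>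
      (integrable_const (1 : ℝ)).indicator (hm k l)

theorem abs_sum_measureReal_gridEvent_sub_le (hS : IsPoissonSampled P Q r X N x₀)
    (hQ : IsMixing Q p C δ) (u h : ℝ≥0) (M : ℕ) :
    |∑ l ∈ Finset.range M, P.real (gridEvent X N u h M l) - gridFreshness Q p r h M| ≤
      Fintype.card S * C * (C + 1) * Real.exp (-(δ * u)) := by
  have hK : 0 ≤ Fintype.card S * C * (C + 1) * Real.exp (-(δ * u)) := by
    have := hQ.const_nonneg
    positivity
  rw [← hS.sum_measureReal_lastJumpIn_mul u h M, ← Finset.sum_sub_distrib]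
  refine (Finset.abs_sum_le_sum_abs _ _).trans (le_trans ?_
    (mul_le_of_le_one_left hK (hS.sum_measureReal_lastJumpIn_le u h M)))
  rw [Finset.sum_mul]
  refine Finset.sum_le_sum fun k hk => ?_
  have h1 := hS.abs_measureReal_sub_le hQ (grid_le u h k.le_succ)
    (grid_le u h (Finset.mem_range.1 hk))
  refine h1.trans (mul_le_mul_of_nonneg_left ?_ measureReal_nonneg)
  have h2 : Real.exp (-(δ * (u + k * h : ℝ≥0))) ≤ Real.exp (-(δ * u)) := by
    rw [Real.exp_le_exp, neg_le_neg_iff]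
    exact mul_le_mul_of_nonneg_left (NNReal.coe_le_coe.2 le_self_add) hQ.rate_nonneg
  refine mul_le_mul_of_nonneg_left h2 ?_
  have := hQ.const_nonneg
  positivity

/-- The first grid ends before the second begins, so every pair of cells has the same minimal gap;
the cell probabilities of each grid then sum to at most one. -/
theorem abs_sum_measureReal_gridEvent_inter_sub_le (hS : IsPoissonSampled P Q r X N x₀)
    (hQ : IsMixing Q p C δ) {u' h' u h : ℝ≥0} {M : ℕ} (hu : u' + M * h' ≤ u) :
    |∑ k ∈ Finset.range M, ∑ l ∈ Finset.range M,
        P.real (gridEvent X N u' h' M k ∩ gridEvent X N u h M l) -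
      (∑ k ∈ Finset.range M, P.real (gridEvent X N u' h' M k)) * gridFreshness Q p r h M| ≤
      Fintype.card S * C * (C + 1) * Real.exp (-(δ * (u - (u' + M * h' : ℝ≥0)))) := by
  set K : ℝ := Fintype.card S * C * (C + 1) *
    Real.exp (-(δ * (u - (u' + M * h' : ℝ≥0)))) with hKdef
  have hK : 0 ≤ K := by
    have := hQ.const_nonneg
    positivity
  rw [← hS.sum_measureReal_lastJumpIn_mul u h M, Finset.sum_mul_sum, ← Finset.sum_sub_distrib]
  simp only [← Finset.sum_sub_distrib]
  refine (Finset.abs_sum_le_sum_abs _ _).trans (le_trans ?_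
    (mul_le_of_le_one_left hK (hS.sum_measureReal_lastJumpIn_le u' h' M)))
  rw [Finset.sum_mul]
  refine Finset.sum_le_sum fun k hk => ?_
  refine (Finset.abs_sum_le_sum_abs _ _).trans (le_trans ?_ (mul_le_mul_of_nonneg_left
    (mul_le_of_le_one_left hK (hS.sum_measureReal_lastJumpIn_le u h M)) measureReal_nonneg))
  rw [Finset.sum_mul, Finset.mul_sum]
  refine Finset.sum_le_sum fun l hl => ?_
  have h1 := hS.abs_measureReal_inter_sub_le hQ (grid_le u' h' k.le_succ)
    (grid_le u' h' (Finset.mem_range.1 hk)) (hu.trans le_self_add) (grid_le u h l.le_succ)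
    (grid_le u h (Finset.mem_range.1 hl))
  refine h1.trans ?_
  refine mul_le_mul_of_nonneg_left (mul_le_mul_of_nonneg_left ?_ measureReal_nonneg)
    measureReal_nonneg
  rw [hKdef]
  have h2 : Real.exp (-(δ * ((u + l * h : ℝ≥0) - (u' + M * h' : ℝ≥0)))) ≤
      Real.exp (-(δ * (u - (u' + M * h' : ℝ≥0)))) := by
    rw [Real.exp_le_exp, neg_le_neg_iff]
    exact mul_le_mul_of_nonneg_left (sub_le_sub_right (NNReal.coe_le_coe.2 le_self_add) _)
      hQ.rate_nonneg
  refine mul_le_mul_of_nonneg_left h2 ?_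
  have := hQ.const_nonneg
  positivity

end IsPoissonSampled

end GridEstimates

end SampledCTMC

/-! ### Mesh to zero: probability of being fresh through a recent sample -/

namespace SampledCTMC

section Limits

variable {S : Type*} [Fintype S] [DecidableEq S] [MeasurableSpace S] [MeasurableSingletonClass S]
  {Ω : Type*} [MeasurableSpace Ω] {P : Measure Ω} [IsProbabilityMeasure P] {Q : Matrix S S ℝ}
  {r : ℝ≥0} {X : ℝ≥0 → Ω → S} {N : ℝ≥0 → Ω → ℕ} {x₀ : Ω → S} {p : S → ℝ} {C δ m : ℝ}

/-- The grid approximations of the freshness on intervals of length `L` have limits, which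
approach `m` as `L` grows. -/
def HasGridLimit (Q : Matrix S S ℝ) (p : S → ℝ) (r : ℝ≥0) (m : ℝ) : Prop :=
  ∀ L : ℝ≥0, ∃ l : ℝ, Tendsto (fun k : ℕ => gridFreshness Q p r (L / (k + 1 : ℕ)) (k + 1)) atTop
    (𝓝 l) ∧ |l - m| ≤ Real.exp (-(r * L))

/-- Each exponential mode contributes its Laplace transform truncated at age `L`. The weights `c`
and `b j` sum to one, so the truncation errors together are at most exp(-rL). -/
theorem hasGridLimit_of_returnProb {ι : Type*} [Fintype ι] {c : ℝ} {b d : ι → ℝ} (hr : 0 < r)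
    (hc : 0 ≤ c) (hb : ∀ j, 0 ≤ b j) (hd : ∀ j, 0 ≤ d j) (hcb : c + ∑ j, b j = 1)
    (hQ : ∀ v : ℝ≥0, returnProb Q p v = c + ∑ j, b j * Real.exp (-d j * v)) :
    HasGridLimit Q p r (c + r * ∑ j, b j / (r + d j)) := by
  intro L
  have hr' : (0 : ℝ) < r := hr
  refine ⟨c * (r / (r + 0) * (1 - Real.exp (-((r + 0) * L)))) +
    ∑ j, b j * (r / (r + d j) * (1 - Real.exp (-((r + d j) * L)))), ?_, ?_⟩
  · have h1 := ((tendsto_geometric_riemann_sum hr' le_rfl L.coe_nonneg).const_mul c).add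
      (tendsto_finsetSum Finset.univ fun j _ =>
        (tendsto_geometric_riemann_sum hr' (hd j) L.coe_nonneg).const_mul (b j))
    refine h1.congr fun k => ?_
    rw [gridFreshness]
    simp only [hQ, Finset.mul_sum, mul_add, Finset.sum_add_distrib]
    rw [Finset.sum_comm]
    push_cast
    congr 1
    · refine Finset.sum_congr rfl fun l _ => ?_
      rw [neg_zero, zero_mul, Real.exp_zero]
      ring
    · refine Finset.sum_congr rfl fun l _ => Finset.sum_congr rfl fun j _ => ?_
      ring
  · have h1 : ∀ j, 0 ≤ b j * (r / (r + d j) * Real.exp (-((r + d j) * L))) := by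
      intro j
      have := hb j
      have := hd j
      positivity
    have h2 : ∀ j, b j * (r / (r + d j) * Real.exp (-((r + d j) * L))) ≤
        b j * Real.exp (-(r * L)) := by
      intro j
      have hj := hd j
      refine mul_le_mul_of_nonneg_left ?_ (hb j)
      refine (mul_le_of_le_one_left (Real.exp_pos _).le ?_).trans (Real.exp_le_exp.2 ?_)
      · rw [div_le_one (by linarith)]
        linarith
      · have := mul_nonneg hj L.coe_nonneg
        linarith
    have h3 : c * (r / (r + 0) * (1 - Real.exp (-((r + 0) * L)))) +
        ∑ j, b j * (r / (r + d j) * (1 - Real.exp (-((r + d j) * L)))) -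
          (c + r * ∑ j, b j / (r + d j)) =
        -(c * Real.exp (-(r * L)) +
          ∑ j, b j * (r / (r + d j) * Real.exp (-((r + d j) * L)))) := by
      have h4 : ∑ j, b j * (r / (r + d j) * (1 - Real.exp (-((r + d j) * L)))) =
          r * ∑ j, b j / (r + d j) -
            ∑ j, b j * (r / (r + d j) * Real.exp (-((r + d j) * L))) := by
        rw [Finset.mul_sum, ← Finset.sum_sub_distrib]
        exact Finset.sum_congr rfl fun j _ => by ring
      rw [h4, add_zero, div_self hr'.ne']
      ring
    rw [h3, abs_neg, abs_of_nonneg (add_nonneg (mul_nonneg hc (Real.exp_pos _).le)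
      (Finset.sum_nonneg fun j _ => h1 j))]
    calc _ ≤ c * Real.exp (-(r * L)) + ∑ j, b j * Real.exp (-(r * L)) :=
          add_le_add le_rfl (Finset.sum_le_sum fun j _ => h2 j)
      _ = Real.exp (-(r * L)) := by rw [← Finset.sum_mul, ← add_mul, hcb, one_mul]

namespace IsPoissonSampled

theorem measurable_sum_indicator_gridEvent (hS : IsPoissonSampled P Q r X N x₀) (u h : ℝ≥0)
    (M : ℕ) : Measurable fun ω =>
      ∑ l ∈ Finset.range M, (gridEvent X N u h M l).indicator (fun _ => (1 : ℝ)) ω :=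
  Finset.measurable_fun_sum _ fun l _ =>
    measurable_const.indicator (hS.measurableSet_gridEvent u h M l)

/-- The source is evaluated at a random time, so measurability comes from the pointwise limit of the
grid sums. -/
theorem measurableSet_freshSince (hS : IsPoissonSampled P Q r X N x₀) {u t : ℝ≥0} (hut : u ≤ t) :
    MeasurableSet (freshSince X N u t) := by
  rw [← measurable_indicator_const_iff (1 : ℝ)]
  refine measurable_of_tendsto_metrizable
    (fun k => hS.measurable_sum_indicator_gridEvent u ((t - u) / (k + 1 : ℕ)) (k + 1))
    (tendsto_pi_nhds.2 fun ω =>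
      hS.poisson.tendsto_sum_indicator_gridEvent hS.chain.right_continuous hut ω)

theorem norm_sum_indicator_gridEvent_le (hS : IsPoissonSampled P Q r X N x₀) (u h : ℝ≥0)
    (M : ℕ) (ω : Ω) :
    ‖∑ l ∈ Finset.range M, (gridEvent X N u h M l).indicator (fun _ => (1 : ℝ)) ω‖ ≤ 1 := by
  rw [Real.norm_of_nonneg (Finset.sum_nonneg fun l _ =>
    Set.indicator_nonneg (fun _ _ => zero_le_one) _)]
  exact hS.poisson.sum_indicator_gridEvent_le_one u h M ω

theorem tendsto_sum_measureReal_gridEvent (hS : IsPoissonSampled P Q r X N x₀) {u t : ℝ≥0}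
    (hut : u ≤ t) :
    Tendsto (fun k : ℕ => ∑ l ∈ Finset.range (k + 1),
      P.real (gridEvent X N u ((t - u) / (k + 1 : ℕ)) (k + 1) l)) atTop
      (𝓝 (P.real (freshSince X N u t))) := by
  have h := tendsto_integral_of_dominated_convergence (μ := P) (fun _ => (1 : ℝ))
    (fun k => (hS.measurable_sum_indicator_gridEvent u
      ((t - u) / (k + 1 : ℕ)) (k + 1)).aestronglyMeasurable)
    (integrable_const 1)
    (fun k => Eventually.of_forall fun ω => hS.norm_sum_indicator_gridEvent_le _ _ _ ω)
    (Eventually.of_forall fun ω =>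
      hS.poisson.tendsto_sum_indicator_gridEvent hS.chain.right_continuous hut ω)
  rw [show ∫ ω, (freshSince X N u t).indicator (fun _ => (1 : ℝ)) ω ∂P =
    P.real (freshSince X N u t) from integral_indicator_one (hS.measurableSet_freshSince hut)] at h
  exact h.congr fun k => hS.integral_sum_indicator_gridEvent _ _ _

theorem tendsto_sum_measureReal_gridEvent_inter (hS : IsPoissonSampled P Q r X N x₀)
    {q s u t : ℝ≥0} (hqs : q ≤ s) (hut : u ≤ t) :
    Tendsto (fun k : ℕ => ∑ i ∈ Finset.range (k + 1), ∑ l ∈ Finset.range (k + 1),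
      P.real (gridEvent X N q ((s - q) / (k + 1 : ℕ)) (k + 1) i ∩
        gridEvent X N u ((t - u) / (k + 1 : ℕ)) (k + 1) l)) atTop
      (𝓝 (P.real (freshSince X N q s ∩ freshSince X N u t))) := by
  have h := tendsto_integral_of_dominated_convergence (μ := P) (fun _ => (1 : ℝ))
    (fun k => ((hS.measurable_sum_indicator_gridEvent q ((s - q) / (k + 1 : ℕ)) (k + 1)).mul
      (hS.measurable_sum_indicator_gridEvent u
      ((t - u) / (k + 1 : ℕ)) (k + 1))).aestronglyMeasurable)
    (integrable_const 1)
    (fun k => Eventually.of_forall fun ω => by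
      rw [Pi.mul_apply, norm_mul]
      exact mul_le_one₀ (hS.norm_sum_indicator_gridEvent_le _ _ _ ω) (norm_nonneg _)
        (hS.norm_sum_indicator_gridEvent_le _ _ _ ω))
    (Eventually.of_forall fun ω =>
      (hS.poisson.tendsto_sum_indicator_gridEvent hS.chain.right_continuous hqs ω).mul
      (hS.poisson.tendsto_sum_indicator_gridEvent hS.chain.right_continuous hut ω))
  have h2 : ∀ ω, (freshSince X N q s).indicator (fun _ => (1 : ℝ)) ω *
      (freshSince X N u t).indicator (fun _ => (1 : ℝ)) ω =
      (freshSince X N q s ∩ freshSince X N u t).indicator (fun _ => (1 : ℝ)) ω := by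
    intro ω
    simpa using (Set.inter_indicator_mul (s := freshSince X N q s)
      (t := freshSince X N u t) (fun _ => (1 : ℝ)) (fun _ => 1) ω).symm
  simp only [h2] at h
  rw [show ∫ ω, (freshSince X N q s ∩ freshSince X N u t).indicator (fun _ => (1 : ℝ)) ω ∂P =
    P.real (freshSince X N q s ∩ freshSince X N u t) from integral_indicator_one
      ((hS.measurableSet_freshSince hqs).inter (hS.measurableSet_freshSince hut))] at h
  exact h.congr fun k => hS.integral_sum_indicator_gridEvent_mul _ _ _ _ _

/-- The grid bounds do not involve the mesh and pass to the limit. The first error is the memory of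
the initial law at time `u`, the second the truncation of sample ages at `t - u`. -/
theorem abs_measureReal_freshSince_sub_le (hS : IsPoissonSampled P Q r X N x₀)
    (hQ : IsMixing Q p C δ) (hm : HasGridLimit Q p r m) {u t : ℝ≥0} (hut : u ≤ t) :
    |P.real (freshSince X N u t) - m| ≤
      Fintype.card S * C * (C + 1) * Real.exp (-(δ * u)) + Real.exp (-(r * (t - u))) := by
  obtain ⟨l, hl, hlm⟩ := hm (t - u)
  rw [NNReal.coe_sub hut] at hlm
  have h1 := le_of_tendsto ((hS.tendsto_sum_measureReal_gridEvent hut).sub hl).abs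
    (Eventually.of_forall fun k => hS.abs_sum_measureReal_gridEvent_sub_le hQ _ _ _)
  exact (abs_sub_le _ l _).trans (add_le_add h1 hlm)

theorem abs_measureReal_freshSince_inter_sub_le (hS : IsPoissonSampled P Q r X N x₀)
    (hQ : IsMixing Q p C δ) (hm : HasGridLimit Q p r m) {q s u t : ℝ≥0} (hqs : q ≤ s)
    (hsu : s ≤ u) (hut : u ≤ t) :
    |P.real (freshSince X N q s ∩ freshSince X N u t) - P.real (freshSince X N q s) * m| ≤
      Fintype.card S * C * (C + 1) * Real.exp (-(δ * (u - s))) + Real.exp (-(r * (t - u))) := by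
  obtain ⟨l, hl, hlm⟩ := hm (t - u)
  rw [NNReal.coe_sub hut] at hlm
  have hM : ∀ k : ℕ, q + (k + 1 : ℕ) * ((s - q) / (k + 1 : ℕ)) = s := by
    intro k
    rw [mul_div_cancel₀ _ (by positivity), add_tsub_cancel_of_le hqs]
  have h1 := le_of_tendsto ((hS.tendsto_sum_measureReal_gridEvent_inter hqs hut).sub
    ((hS.tendsto_sum_measureReal_gridEvent hqs).mul hl)).abs
    (Eventually.of_forall fun k => by
      have := hS.abs_sum_measureReal_gridEvent_inter_sub_le hQ (u' := q)
        (h' := (s - q) / (k + 1 : ℕ)) (u := u) (h := (t - u) / (k + 1 : ℕ)) (M := k + 1)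
        (by rw [hM]; exact hsu)
      rwa [hM] at this)
  refine (abs_sub_le _ (P.real (freshSince X N q s) * l) _).trans (add_le_add h1 ?_)
  rw [← mul_sub, abs_mul, abs_of_nonneg measureReal_nonneg]
  exact (mul_le_of_le_one_left (abs_nonneg _) measureReal_le_one).trans hlm

theorem measurableSet_estimator_eq (hS : IsPoissonSampled P Q r X N x₀) (t : ℝ≥0) :
    MeasurableSet {ω | estimator X N x₀ t ω = X t ω} := by
  have h : {ω | estimator X N x₀ t ω = X t ω} =
      freshSince X N 0 t ∪ ({ω | N t ω = 0} ∩ {ω | x₀ ω = X t ω}) := by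
    ext ω
    obtain h0 | h0 := (Nat.zero_le (N t ω)).eq_or_lt
    · simp [hS.poisson.estimator_eq, freshSince, ← h0]
    · simp [hS.poisson.estimator_eq, freshSince, h0, h0.ne', hS.poisson.zero]
  rw [h]
  exact (hS.measurableSet_freshSince zero_le).union
    ((measurableSet_eq_fun (hS.poisson.measurable t) measurable_const).inter
      (measurableSet_eq_fun hS.measurable_init (hS.chain.measurable t)))

/-- The two can differ only if there is no sample in `(u, t]`. This disposes of the initial guess,
about whose dependence on the processes nothing is assumed. -/
theorem abs_freshness_sub_indicator_le (hS : IsPoissonSampled P Q r X N x₀) {u t : ℝ≥0}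
    (hut : u ≤ t) (ω : Ω) :
    |freshness X N x₀ t ω - (freshSince X N u t).indicator (fun _ => (1 : ℝ)) ω| ≤
      {ω | N u ω = N t ω}.indicator (fun _ => (1 : ℝ)) ω := by
  obtain h0 | h0 := (hS.poisson.mono ω hut).eq_or_lt
  · rw [Set.indicator_of_mem (s := {ω | N u ω = N t ω}) h0, freshness,
      Set.indicator_of_notMem fun h => h.1.ne h0]
    split_ifs <;> simp
  · rw [Set.indicator_of_notMem (s := {ω | N u ω = N t ω}) h0.ne, freshness]
    have h1 := hS.poisson.mem_freshSince_iff (X := X) (x₀ := x₀) h0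
    by_cases h : ω ∈ freshSince X N u t
    · rw [if_pos (h1.1 h), Set.indicator_of_mem h, sub_self, abs_zero]
    · rw [if_neg (h1.not.1 h), Set.indicator_of_notMem h, sub_self, abs_zero]

theorem integral_indicator_eval_eq (hS : IsPoissonSampled P Q r X N x₀) {u t : ℝ≥0}
    (hut : u ≤ t) :
    ∫ ω, {ω | N u ω = N t ω}.indicator (fun _ => (1 : ℝ)) ω ∂P =
      Real.exp (-(r * (t - u))) := by
  rw [← hS.poisson.measureReal_eval_eq hut]
  exact integral_indicator_one
    (measurableSet_eq_fun (hS.poisson.measurable u) (hS.poisson.measurable t))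

theorem measurable_freshness (hS : IsPoissonSampled P Q r X N x₀) (t : ℝ≥0) :
    Measurable (freshness X N x₀ t) :=
  Measurable.ite (hS.measurableSet_estimator_eq t) measurable_const measurable_const

theorem freshness_mem_Icc (X : ℝ≥0 → Ω → S) (N : ℝ≥0 → Ω → ℕ) (x₀ : Ω → S) (t : ℝ≥0) (ω : Ω) :
    freshness X N x₀ t ω ∈ Set.Icc (0 : ℝ) 1 := by
  rw [freshness]
  split_ifs <;> simp

theorem integral_freshness (hS : IsPoissonSampled P Q r X N x₀) (t : ℝ≥0) :
    ∫ ω, freshness X N x₀ t ω ∂P = P.real {ω | estimator X N x₀ t ω = X t ω} := by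
  rw [← integral_indicator_one (hS.measurableSet_estimator_eq t)]
  refine integral_congr_ae (Eventually.of_forall fun ω => ?_)
  simp [freshness, Set.indicator_apply]

end IsPoissonSampled

end Limits

end SampledCTMC

/-! ### Convergence of the freshness probability and decay of covariances -/

namespace SampledCTMC

section Covariance

variable {S : Type*} [Fintype S] [DecidableEq S] [MeasurableSpace S] [MeasurableSingletonClass S]
  {Ω : Type*} [MeasurableSpace Ω] {P : Measure Ω} [IsProbabilityMeasure P] {Q : Matrix S S ℝ}
  {r : ℝ≥0} {X : ℝ≥0 → Ω → S} {N : ℝ≥0 → Ω → ℕ} {x₀ : Ω → S} {p : S → ℝ} {C δ m c : ℝ}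

theorem abs_sub_le_one_of_mem_Icc {x y : ℝ} (hx : x ∈ Set.Icc (0 : ℝ) 1)
    (hy : y ∈ Set.Icc (0 : ℝ) 1) : |x - y| ≤ 1 := by
  rw [abs_le]
  constructor <;> linarith [hx.1, hx.2, hy.1, hy.2]

namespace IsPoissonSampled

theorem integrable_freshness (hS : IsPoissonSampled P Q r X N x₀) (t : ℝ≥0) :
    Integrable (freshness X N x₀ t) P :=
  Integrable.of_mem_Icc 0 1 (hS.measurable_freshness t).aemeasurable
    (Eventually.of_forall fun ω => freshness_mem_Icc X N x₀ t ω)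

/-- The probability of being fresh converges exponentially fast. -/
theorem abs_measureReal_estimator_eq_sub_le (hS : IsPoissonSampled P Q r X N x₀)
    (hQ : IsMixing Q p C δ) (hm : HasGridLimit Q p r m) (hcδ : 2 * c ≤ δ) (hcr : 2 * c ≤ r)
    (t : ℝ≥0) :
    |P.real {ω | estimator X N x₀ t ω = X t ω} - m| ≤
      (Fintype.card S * C * (C + 1) + 2) * Real.exp (-(c * t)) := by
  -- The source mixes during the first half of `[0, t]` and a sample is expected in the second;
  -- hence the factors 2 in `hcδ` and `hcr`. The summand 2 in the constant counts the missing-sample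
  -- and truncation errors.
  have hut : t / 2 ≤ t := half_le_self zero_le
  have h1 := hS.abs_measureReal_freshSince_sub_le hQ hm hut
  have h2 : |∫ ω, (freshness X N x₀ t ω -
      (freshSince X N (t / 2) t).indicator (fun _ => (1 : ℝ)) ω) ∂P| ≤
      Real.exp (-(r * (t - (t / 2 : ℝ≥0)))) := by
    rw [← hS.integral_indicator_eval_eq hut]
    refine abs_integral_le_integral_abs.trans (integral_mono_of_nonneg
      (Eventually.of_forall fun ω => abs_nonneg _) ((integrable_const (1 : ℝ)).indicator
      (measurableSet_eq_fun (hS.poisson.measurable _) (hS.poisson.measurable _)))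
      (Eventually.of_forall fun ω => hS.abs_freshness_sub_indicator_le hut ω))
  rw [integral_sub (hS.integrable_freshness t)
    ((integrable_const (1 : ℝ)).indicator (hS.measurableSet_freshSince hut)),
    hS.integral_freshness, show ∫ ω, (freshSince X N (t / 2) t).indicator (fun _ => (1 : ℝ)) ω ∂P =
      P.real (freshSince X N (t / 2) t) from
      integral_indicator_one (hS.measurableSet_freshSince hut)] at h2
  have h3 : Real.exp (-(r * (t - (t / 2 : ℝ≥0)))) ≤ Real.exp (-(c * t)) := by
    rw [Real.exp_le_exp]
    have := mul_le_mul_of_nonneg_right hcr t.coe_nonneg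
    push_cast
    linarith
  have h4 : Real.exp (-(δ * (t / 2 : ℝ≥0))) ≤ Real.exp (-(c * t)) := by
    rw [Real.exp_le_exp]
    have := mul_le_mul_of_nonneg_right hcδ t.coe_nonneg
    push_cast
    linarith
  have hK : 0 ≤ Fintype.card S * C * (C + 1) := by
    have := hQ.const_nonneg
    positivity
  have h5 := mul_le_mul_of_nonneg_left h4 hK
  have h6 := abs_sub_le (P.real {ω | estimator X N x₀ t ω = X t ω})
    (P.real (freshSince X N (t / 2) t)) m
  linarith

theorem tendsto_measureReal_estimator_eq (hS : IsPoissonSampled P Q r X N x₀)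
    (hQ : IsMixing Q p C δ) (hm : HasGridLimit Q p r m) (hc : 0 < c) (hcδ : 2 * c ≤ δ)
    (hcr : 2 * c ≤ r) :
    Tendsto (fun t => P.real {ω | estimator X N x₀ t ω = X t ω}) atTop (𝓝 m) := by
  rw [tendsto_iff_norm_sub_tendsto_zero]
  refine squeeze_zero (fun t => norm_nonneg _)
    (fun t => hS.abs_measureReal_estimator_eq_sub_le hQ hm hcδ hcr t) ?_
  have h1 : Tendsto (fun t : ℝ≥0 => c * (t : ℝ)) atTop atTop :=
    (NNReal.tendsto_coe_atTop.2 tendsto_id).const_mul_atTop hc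
  simpa using (Real.tendsto_exp_neg_atTop_nhds_zero.comp h1).const_mul
    ((Fintype.card S * C * (C + 1) + 2 : ℝ))

/-- The freshness at distant times is almost uncorrelated. -/
theorem abs_integral_freshness_mul_le (hS : IsPoissonSampled P Q r X N x₀)
    (hQ : IsMixing Q p C δ) (hm : HasGridLimit Q p r m) (hm01 : m ∈ Set.Icc (0 : ℝ) 1)
    (hcδ : 2 * c ≤ δ) (hcr : 2 * c ≤ r) {s t : ℝ≥0} (hst : s ≤ t) :
    |∫ ω, (freshness X N x₀ s ω - m) * (freshness X N x₀ t ω - m) ∂P| ≤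
      2 * (Fintype.card S * C * (C + 1) + 2) *
        (Real.exp (-(c * (t - s))) + Real.exp (-(c * s))) := by
  -- The source mixes on `[s, u]`, and a sample is expected in `(u, t]`. Freshness at `s` is
  -- replaced by freshness since 0, at `t` by freshness since `u`; a missing sample before `s`
  -- causes the term exp(-cs).
  set u : ℝ≥0 := (s + t) / 2 with hu
  have hsu : s ≤ u := by
    rw [← NNReal.coe_le_coe] at hst ⊢
    push_cast [hu]
    linarith
  have hut : u ≤ t := by
    rw [← NNReal.coe_le_coe] at hst ⊢
    push_cast [hu]
    linarith
  set f := (freshSince X N 0 s).indicator (fun _ => (1 : ℝ)) with hf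
  set g := (freshSince X N u t).indicator (fun _ => (1 : ℝ)) with hg
  have mf := hS.measurableSet_freshSince (zero_le : 0 ≤ s)
  have mg := hS.measurableSet_freshSince hut
  have intf : Integrable f P := (integrable_const (1 : ℝ)).indicator mf
  have intg : Integrable g P := (integrable_const (1 : ℝ)).indicator mg
  have hf01 : ∀ ω, f ω ∈ Set.Icc (0 : ℝ) 1 := fun ω =>
    ⟨Set.indicator_nonneg (fun _ _ => zero_le_one) _,
      Set.indicator_apply_le' (fun _ => le_rfl) (fun _ => zero_le_one)⟩
  have hfg : ∀ ω, f ω * g ω =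
      (freshSince X N 0 s ∩ freshSince X N u t).indicator (fun _ => (1 : ℝ)) ω := by
    intro ω
    simpa using (Set.inter_indicator_mul (s := freshSince X N 0 s)
      (t := freshSince X N u t) (fun _ => (1 : ℝ)) (fun _ => 1) ω).symm
  have intfg : Integrable (fun ω => f ω * g ω) P := by
    simp only [hfg]
    exact (integrable_const (1 : ℝ)).indicator (mf.inter mg)
  have efg : ∫ ω, f ω * g ω ∂P = P.real (freshSince X N 0 s ∩ freshSince X N u t) := by
    simp only [hfg]
    exact integral_indicator_one (mf.inter mg)
  have ef : ∫ ω, f ω ∂P = P.real (freshSince X N 0 s) := integral_indicator_one mf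
  have eg : ∫ ω, g ω ∂P = P.real (freshSince X N u t) := integral_indicator_one mg
  have hexp : ∀ ω, (f ω - m) * (g ω - m) = f ω * g ω - m * f ω - m * g ω + m * m := fun ω => by
    ring
  have int2 : Integrable (fun ω => (f ω - m) * (g ω - m)) P := by
    simp only [hexp]
    exact ((intfg.sub (intf.const_mul m)).sub (intg.const_mul m)).add (integrable_const _)
  -- The centred product splits into the errors of the two-interval and the one-interval estimates.
  have e2 : ∫ ω, (f ω - m) * (g ω - m) ∂P =
      (P.real (freshSince X N 0 s ∩ freshSince X N u t) - P.real (freshSince X N 0 s) * m) -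
        m * (P.real (freshSince X N u t) - m) := by
    simp only [hexp]
    have i1 : Integrable (fun ω => f ω * g ω - m * f ω) P := intfg.sub (intf.const_mul m)
    have i2 : Integrable (fun ω => f ω * g ω - m * f ω - m * g ω) P := i1.sub (intg.const_mul m)
    rw [integral_add i2 (integrable_const _), integral_sub i1 (intg.const_mul m),
      integral_sub intfg (intf.const_mul m), integral_const_mul, integral_const_mul, efg, ef, eg]
    simp
    ring
  have int1 : Integrable (fun ω => (freshness X N x₀ s ω - m) * (freshness X N x₀ t ω - m)) P := by
    refine Integrable.of_bound (C := 1) (((hS.measurable_freshness s).sub_const m).mul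
      ((hS.measurable_freshness t).sub_const m)).aestronglyMeasurable
      (Eventually.of_forall fun ω => ?_)
    rw [norm_mul]
    exact mul_le_one₀ (abs_sub_le_one_of_mem_Icc (freshness_mem_Icc X N x₀ s ω) hm01)
      (norm_nonneg _) (abs_sub_le_one_of_mem_Icc (freshness_mem_Icc X N x₀ t ω) hm01)
  have hdiff : |∫ ω, ((freshness X N x₀ s ω - m) * (freshness X N x₀ t ω - m) -
      (f ω - m) * (g ω - m)) ∂P| ≤
      Real.exp (-(r * (s - (0 : ℝ≥0)))) + Real.exp (-(r * (t - u))) := by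
    have i1 : Integrable ({ω | N 0 ω = N s ω}.indicator (fun _ => (1 : ℝ))) P :=
      (integrable_const (1 : ℝ)).indicator
        (measurableSet_eq_fun (hS.poisson.measurable _) (hS.poisson.measurable _))
    have i2 : Integrable ({ω | N u ω = N t ω}.indicator (fun _ => (1 : ℝ))) P :=
      (integrable_const (1 : ℝ)).indicator
        (measurableSet_eq_fun (hS.poisson.measurable _) (hS.poisson.measurable _))
    rw [← hS.integral_indicator_eval_eq (zero_le : 0 ≤ s), ← hS.integral_indicator_eval_eq hut,
      ← integral_add i1 i2]
    refine abs_integral_le_integral_abs.trans (integral_mono_of_nonneg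
      (Eventually.of_forall fun ω => abs_nonneg _) (i1.add i2)
      (Eventually.of_forall fun ω => ?_))
    have h1 := hS.abs_freshness_sub_indicator_le (zero_le : 0 ≤ s) ω
    have h2 := hS.abs_freshness_sub_indicator_le hut ω
    have h3 := abs_sub_le_one_of_mem_Icc (freshness_mem_Icc X N x₀ t ω) hm01
    have h4 := abs_sub_le_one_of_mem_Icc (hf01 ω) hm01
    have h5 : (freshness X N x₀ s ω - m) * (freshness X N x₀ t ω - m) -
        (f ω - m) * (g ω - m) = (freshness X N x₀ s ω - f ω) * (freshness X N x₀ t ω - m) +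
          (f ω - m) * (freshness X N x₀ t ω - g ω) := by ring
    simp only [h5]
    refine (abs_add_le _ _).trans (add_le_add ?_ ?_)
    · rw [abs_mul]
      exact (mul_le_of_le_one_right (abs_nonneg _) h3).trans h1
    · rw [abs_mul]
      exact (mul_le_of_le_one_left (abs_nonneg _) h4).trans h2
  rw [integral_sub int1 int2, e2] at hdiff
  have hA := hS.abs_measureReal_freshSince_inter_sub_le hQ hm (zero_le : 0 ≤ s) hsu hut
  have hB := hS.abs_measureReal_freshSince_sub_le hQ hm hut
  have hB' : |m * (P.real (freshSince X N u t) - m)| ≤ |P.real (freshSince X N u t) - m| := by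
    rw [abs_mul, abs_of_nonneg hm01.1]
    exact mul_le_of_le_one_left (abs_nonneg _) hm01.2
  have hst' : (s : ℝ) ≤ t := hst
  have hcu : (u : ℝ) = (s + t) / 2 := by push_cast [hu]; rfl
  have k1 : Real.exp (-(r * (t - u))) ≤ Real.exp (-(c * (t - s))) := by
    rw [Real.exp_le_exp, hcu]
    have := mul_le_mul_of_nonneg_right hcr (sub_nonneg.2 hst')
    linarith
  have k2 : Real.exp (-(δ * (u - s))) ≤ Real.exp (-(c * (t - s))) := by
    rw [Real.exp_le_exp, hcu]
    have := mul_le_mul_of_nonneg_right hcδ (sub_nonneg.2 hst')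
    linarith
  have k3 : Real.exp (-(δ * u)) ≤ Real.exp (-(δ * (u - s))) := by
    rw [Real.exp_le_exp]
    have := mul_nonneg hQ.rate_nonneg s.coe_nonneg
    linarith
  have k4 : Real.exp (-(r * (s - (0 : ℝ≥0)))) ≤ 2 * Real.exp (-(c * s)) := by
    have : Real.exp (-(r * (s - (0 : ℝ≥0)))) ≤ Real.exp (-(c * s)) := by
      rw [Real.exp_le_exp, NNReal.coe_zero, sub_zero]
      have h1 := mul_le_mul_of_nonneg_right hcr s.coe_nonneg
      have h2 := mul_nonneg r.coe_nonneg s.coe_nonneg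
      linarith
    linarith [Real.exp_pos (-(c * s))]
  set K : ℝ := Fintype.card S * C * (C + 1) with hKdef
  have hK : 0 ≤ K := by
    have := hQ.const_nonneg
    positivity
  have k5 := mul_le_mul_of_nonneg_left k2 hK
  have k6 := mul_le_mul_of_nonneg_left (k3.trans k2) hK
  have k7 := mul_nonneg hK (Real.exp_pos (-(c * s))).le
  have k8 := Real.exp_pos (-(c * s))
  have k9 := Real.exp_pos (-(c * (t - s)))
  have l1 := abs_sub_abs_le_abs_sub (∫ ω, (freshness X N x₀ s ω - m) *
    (freshness X N x₀ t ω - m) ∂P)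
    ((P.real (freshSince X N 0 s ∩ freshSince X N u t) - P.real (freshSince X N 0 s) * m) -
        m * (P.real (freshSince X N u t) - m))
  have l2 := abs_sub (P.real (freshSince X N 0 s ∩ freshSince X N u t) -
    P.real (freshSince X N 0 s) * m) (m * (P.real (freshSince X N u t) - m))
  linarith

end IsPoissonSampled

end Covariance

end SampledCTMC

/-! ### A strong law from decaying covariances, and its application -/

namespace SampledCTMC

section TimeAverage

theorem integrable_exp_neg_mul_abs {c : ℝ} (hc : 0 < c) :
    Integrable (fun x : ℝ => Real.exp (-(c * |x|))) := by
  rw [← integrableOn_univ, ← Set.Iic_union_Ioi (a := (0 : ℝ))]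
  refine IntegrableOn.union ?_ ?_
  · refine (integrableOn_exp_mul_Iic hc 0).congr_fun (fun x hx => ?_) measurableSet_Iic
    simp only [abs_of_nonpos (Set.mem_Iic.1 hx)]
    congr 1
    ring
  · refine (exp_neg_integrableOn_Ioi 0 hc).congr_fun (fun x hx => ?_) measurableSet_Ioi
    simp only [abs_of_pos (Set.mem_Ioi.1 hx)]
    congr 1
    ring

variable {Ω : Type*} [MeasurableSpace Ω] {P : Measure Ω} [IsProbabilityMeasure P]
  {G : ℝ → Ω → ℝ} {K c : ℝ}

/-- A process whose covariances decay exponentially has integrals of linearly growing second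
moment. -/
theorem integral_sq_integral_le (hmeas : Measurable (Function.uncurry G))
    (hG : ∀ t ω, |G t ω| ≤ 1) (hK : 0 ≤ K) (hc : 0 < c)
    (hcov : ∀ s t, 0 ≤ s → s ≤ t → |∫ ω, G s ω * G t ω ∂P| ≤
      K * (Real.exp (-(c * (t - s))) + Real.exp (-(c * s)))) {τ : ℝ} (hτ : 0 ≤ τ) :
    ∫ ω, (∫ t in Set.Ioc 0 τ, G t ω) ^ 2 ∂P ≤
      3 * K * (∫ x, Real.exp (-(c * |x|))) * τ := by
  set φ : ℝ → ℝ := fun x => Real.exp (-(c * |x|)) with hφ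
  set ν : Measure ℝ := volume.restrict (Set.Ioc 0 τ) with hν
  have hφm : Measurable φ := by fun_prop
  have hφ0 : ∀ x, 0 ≤ φ x := fun x => (Real.exp_pos _).le
  have hφ1 : ∀ x, ‖φ x‖ ≤ 1 := fun x => by
    rw [Real.norm_of_nonneg (hφ0 x), hφ, Real.exp_le_one_iff, neg_nonpos]
    positivity
  have hφi : Integrable φ := integrable_exp_neg_mul_abs hc
  have hνu : ν.real Set.univ = τ := by
    rw [hν, measureReal_restrict_apply_univ, Real.volume_real_Ioc_of_le hτ, sub_zero]
  have h1 : ∀ ω, (∫ t, G t ω ∂ν) ^ 2 = ∫ z, G z.1 ω * G z.2 ω ∂(ν.prod ν) := fun ω => by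
    rw [sq, integral_prod_mul (fun t => G t ω) (fun t => G t ω)]
  have hint : Integrable (Function.uncurry fun (ω : Ω) (z : ℝ × ℝ) => G z.1 ω * G z.2 ω)
      (P.prod (ν.prod ν)) := by
    refine Integrable.of_bound (C := 1) (Measurable.aestronglyMeasurable ?_)
      (Eventually.of_forall fun x => ?_)
    · exact (hmeas.comp (measurable_snd.fst.prodMk measurable_fst)).mul
        (hmeas.comp (measurable_snd.snd.prodMk measurable_fst))
    · simp only [Function.uncurry, norm_mul]
      exact mul_le_one₀ (hG _ _) (norm_nonneg _) (hG _ _)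
  have i1 : Integrable (fun z : ℝ × ℝ => φ (z.2 - z.1)) (ν.prod ν) :=
    Integrable.of_bound (C := 1) (by fun_prop) (Eventually.of_forall fun z => hφ1 _)
  have i2 : Integrable (fun z : ℝ × ℝ => φ z.1) (ν.prod ν) :=
    Integrable.of_bound (C := 1) (by fun_prop) (Eventually.of_forall fun z => hφ1 _)
  have i3 : Integrable (fun z : ℝ × ℝ => φ z.2) (ν.prod ν) :=
    Integrable.of_bound (C := 1) (by fun_prop) (Eventually.of_forall fun z => hφ1 _)
  have hle : ∫ x, φ x ∂ν ≤ ∫ x, φ x :=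
    integral_mono_measure Measure.restrict_le_self (Eventually.of_forall hφ0) hφi
  -- By translation invariance each inner integral is at most the integral of `φ` over the line, so
  -- the double integral grows only linearly in `τ`.
  have e1 : ∫ z, φ (z.2 - z.1) ∂(ν.prod ν) ≤ (∫ x, φ x) * τ := by
    rw [integral_prod _ i1]
    calc ∫ s, ∫ t, φ (t - s) ∂ν ∂ν ≤ ∫ _s, (∫ x, φ x) ∂ν := by
          refine integral_mono i1.integral_prod_left (integrable_const _) fun s => ?_
          rw [← integral_sub_right_eq_self φ s]
          exact integral_mono_measure Measure.restrict_le_self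
            (Eventually.of_forall fun t => hφ0 _) (hφi.comp_sub_right s)
      _ = (∫ x, φ x) * τ := by rw [integral_const, hνu, smul_eq_mul, mul_comm]
  have e2 : ∫ z, φ z.1 ∂(ν.prod ν) ≤ (∫ x, φ x) * τ := by
    rw [integral_fun_fst, hνu, smul_eq_mul, mul_comm]
    exact mul_le_mul_of_nonneg_right hle hτ
  have e3 : ∫ z, φ z.2 ∂(ν.prod ν) ≤ (∫ x, φ x) * τ := by
    rw [integral_fun_snd, hνu, smul_eq_mul, mul_comm]
    exact mul_le_mul_of_nonneg_right hle hτ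
  -- Adding both `φ s` and `φ t` makes the covariance bound symmetric, so it holds on the whole
  -- square.
  have key : ∀ s t, 0 ≤ s → 0 ≤ t →
      ∫ ω, G s ω * G t ω ∂P ≤ K * (φ (t - s) + φ s + φ t) := by
    intro s t hs ht
    rcases le_total s t with hst | hst
    · refine (le_abs_self _).trans ((hcov s t hs hst).trans (mul_le_mul_of_nonneg_left ?_ hK))
      simp only [hφ, abs_of_nonneg (sub_nonneg.2 hst), abs_of_nonneg hs]
      linarith [Real.exp_pos (-(c * |t|))]
    · simp only [mul_comm (G s _)]
      refine (le_abs_self _).trans ((hcov t s ht hst).trans (mul_le_mul_of_nonneg_left ?_ hK))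
      simp only [hφ, abs_sub_comm t s, abs_of_nonneg (sub_nonneg.2 hst), abs_of_nonneg ht]
      linarith [Real.exp_pos (-(c * |s|))]
  have hae : ∀ᵐ z ∂(ν.prod ν), z ∈ Set.Ioc 0 τ ×ˢ Set.Ioc 0 τ := by
    rw [hν, Measure.prod_restrict]
    exact ae_restrict_mem (measurableSet_Ioc.prod measurableSet_Ioc)
  simp only [h1]
  rw [integral_integral_swap hint]
  calc ∫ z, ∫ ω, G z.1 ω * G z.2 ω ∂P ∂(ν.prod ν)
      ≤ ∫ z, K * (φ (z.2 - z.1) + φ z.1 + φ z.2) ∂(ν.prod ν) := by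
        refine integral_mono_ae hint.integral_prod_right (((i1.add i2).add i3).const_mul K) ?_
        filter_upwards [hae] with z hz
        exact key z.1 z.2 hz.1.1.le hz.2.1.le
    _ = K * (∫ z, φ (z.2 - z.1) ∂(ν.prod ν) + ∫ z, φ z.1 ∂(ν.prod ν) +
          ∫ z, φ z.2 ∂(ν.prod ν)) := by
        have i12 : Integrable (fun z : ℝ × ℝ => φ (z.2 - z.1) + φ z.1) (ν.prod ν) := i1.add i2
        rw [integral_const_mul, integral_add i12 i3, integral_add i1 i2]
    _ ≤ K * ((∫ x, φ x) * τ + (∫ x, φ x) * τ + (∫ x, φ x) * τ) :=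
        mul_le_mul_of_nonneg_left (by linarith) hK
    _ = 3 * K * (∫ x, φ x) * τ := by ring

/-- If the averages of a bounded function converge along the squares, they converge. -/
theorem tendsto_average_of_tendsto_sq {g : ℝ → ℝ} (hg : Measurable g) (hb : ∀ t, |g t| ≤ 1)
    (h : Tendsto (fun k : ℕ => ((k : ℝ) ^ 2)⁻¹ * ∫ t in (0 : ℝ)..(k : ℝ) ^ 2, g t) atTop (𝓝 0)) :
    Tendsto (fun τ : ℝ => τ⁻¹ * ∫ t in (0 : ℝ)..τ, g t) atTop (𝓝 0) := by
  have hgi : ∀ a b, IntervalIntegrable g volume a b := fun a b =>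
    (intervalIntegrable_const (c := (1 : ℝ))).mono_fun' hg.aestronglyMeasurable
      (Eventually.of_forall hb)
  -- With k = ⌊√τ⌋, the integrals up to τ and up to k² differ by at most 2k + 1, which is negligible
  -- against k².
  have hk : Tendsto (fun τ : ℝ => ⌊√τ⌋₊) atTop atTop :=
    tendsto_nat_floor_atTop.comp Real.tendsto_sqrt_atTop
  have h2 : Tendsto (fun k : ℕ => (2 * k + 1 : ℝ) * ((k : ℝ) ^ 2)⁻¹) atTop (𝓝 0) := by
    have h3 := tendsto_inv_atTop_nhds_zero_nat (𝕜 := ℝ)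
    have h4 := (h3.const_mul 2).add (h3.mul h3)
    rw [mul_zero, mul_zero, add_zero] at h4
    refine h4.congr fun k => ?_
    obtain rfl | hk := eq_or_ne k 0
    · simp
    · have : (k : ℝ) ≠ 0 := by exact_mod_cast hk
      field_simp
  have h5 := (h.abs.add h2).comp hk
  rw [abs_zero, add_zero] at h5
  refine squeeze_zero_norm' ?_ h5
  filter_upwards [eventually_ge_atTop 1] with τ hτ
  simp only [Function.comp_apply]
  set k := ⌊√τ⌋₊ with hkdef
  have hk1 : (k : ℝ) ≤ √τ := Nat.floor_le (Real.sqrt_nonneg _)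
  have hk2 : √τ < k + 1 := Nat.lt_floor_add_one _
  have hk0 : 1 ≤ k := by
    rw [hkdef, Nat.one_le_floor_iff, Real.one_le_sqrt]
    exact hτ
  have hk0' : (1 : ℝ) ≤ k := by exact_mod_cast hk0
  have hs := Real.sq_sqrt (zero_le_one.trans hτ)
  have hkτ : (k : ℝ) ^ 2 ≤ τ := by
    rw [← hs]
    gcongr
  have hkτ' : τ - (k : ℝ) ^ 2 ≤ 2 * k + 1 := by
    have : √τ ^ 2 ≤ (k + 1 : ℝ) ^ 2 := by gcongr
    rw [hs] at this
    linarith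
  have hkpos : (0 : ℝ) < (k : ℝ) ^ 2 := by positivity
  have hinc : |∫ t in (k : ℝ) ^ 2..τ, g t| ≤ 2 * k + 1 := by
    have := intervalIntegral.norm_integral_le_of_norm_le_const (a := (k : ℝ) ^ 2) (b := τ)
      (f := g) (C := 1) fun t _ => hb t
    rw [one_mul, abs_of_nonneg (sub_nonneg.2 hkτ)] at this
    exact this.trans hkτ'
  rw [← intervalIntegral.integral_add_adjacent_intervals (hgi 0 ((k : ℝ) ^ 2)) (hgi _ τ),
    norm_mul, norm_inv, Real.norm_of_nonneg (zero_le_one.trans hτ), abs_mul, abs_inv,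
    abs_of_pos hkpos]
  have hinv : τ⁻¹ ≤ ((k : ℝ) ^ 2)⁻¹ := inv_anti₀ hkpos hkτ
  calc τ⁻¹ * ‖(∫ t in (0 : ℝ)..(k : ℝ) ^ 2, g t) + ∫ t in (k : ℝ) ^ 2..τ, g t‖
      ≤ ((k : ℝ) ^ 2)⁻¹ * (|∫ t in (0 : ℝ)..(k : ℝ) ^ 2, g t| + (2 * k + 1)) := by
        refine mul_le_mul hinv ?_ (norm_nonneg _) (inv_nonneg.2 hkpos.le)
        exact (norm_add_le _ _).trans (add_le_add le_rfl hinc)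
    _ = _ := by ring

/-- A strong law of large numbers for processes with exponentially decaying covariances. -/
theorem ae_tendsto_average (hmeas : Measurable (Function.uncurry G))
    (hG : ∀ t ω, |G t ω| ≤ 1) (hK : 0 ≤ K) (hc : 0 < c)
    (hcov : ∀ s t, 0 ≤ s → s ≤ t → |∫ ω, G s ω * G t ω ∂P| ≤
      K * (Real.exp (-(c * (t - s))) + Real.exp (-(c * s)))) :
    ∀ᵐ ω ∂P, Tendsto (fun τ : ℝ => τ⁻¹ * ∫ t in (0 : ℝ)..τ, G t ω) atTop (𝓝 0) := by
  set Z : ℕ → Ω → ℝ := fun k ω => ((k : ℝ) ^ 2)⁻¹ * ∫ t in Set.Ioc 0 ((k : ℝ) ^ 2), G t ω with hZ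
  set B : ℝ := 3 * K * ∫ x, Real.exp (-(c * |x|)) with hB
  have hZm : ∀ k, Measurable (Z k) := fun k => by
    have h1 : StronglyMeasurable (Function.uncurry fun ω t => G t ω) :=
      (hmeas.comp measurable_swap).stronglyMeasurable
    exact h1.integral_prod_right.measurable.const_mul _
  have hZb : ∀ k ω, |Z k ω| ≤ 1 := fun k ω => by
    have h1 := norm_setIntegral_le_of_norm_le_const (μ := volume) (s := Set.Ioc 0 ((k : ℝ) ^ 2))
      (f := fun t => G t ω) (C := 1) (by simp) fun t _ => hG t ω
    rw [Real.volume_real_Ioc_of_le (by positivity), sub_zero, one_mul] at h1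
    rw [hZ, abs_mul, abs_inv, abs_of_nonneg (by positivity)]
    refine (mul_le_mul_of_nonneg_left h1 (by positivity)).trans ?_
    exact inv_mul_le_one
  have hZ2 : ∀ k, ∫ ω, Z k ω ^ 2 ∂P ≤ B * ((k : ℝ) ^ 2)⁻¹ := fun k => by
    have h1 := integral_sq_integral_le hmeas hG hK hc hcov (τ := (k : ℝ) ^ 2) (by positivity)
    simp only [hZ, mul_pow, integral_const_mul]
    refine (mul_le_mul_of_nonneg_left h1 (by positivity)).trans_eq ?_
    obtain rfl | hk := eq_or_ne k 0
    · simp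
    · have : (k : ℝ) ≠ 0 := by exact_mod_cast hk
      field_simp
      rw [hB]
  have hsum : Summable fun k : ℕ => B * ((k : ℝ) ^ 2)⁻¹ :=
    (Real.summable_nat_pow_inv.2 one_lt_two).mul_left B
  have hB0 : 0 ≤ B := mul_nonneg (by positivity) (integral_nonneg fun x => (Real.exp_pos _).le)
  -- The second moments along squares are O(1/k²), so the sum of the `Z k ω ^ 2` has finite
  -- expectation and is almost surely finite; its terms then tend to zero.
  have hfin : ∫⁻ ω, ∑' k, ENNReal.ofReal (Z k ω ^ 2) ∂P ≠ ⊤ := by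
    rw [lintegral_tsum fun k => ((hZm k).pow_const 2).ennreal_ofReal.aemeasurable]
    refine ne_top_of_le_ne_top (b := ∑' k : ℕ, ENNReal.ofReal (B * ((k : ℝ) ^ 2)⁻¹)) ?_ ?_
    · rw [← ENNReal.ofReal_tsum_of_nonneg (fun k => by positivity) hsum]
      exact ENNReal.ofReal_ne_top
    · refine ENNReal.tsum_le_tsum fun k => ?_
      rw [← ofReal_integral_eq_lintegral_ofReal _ (Eventually.of_forall fun ω => sq_nonneg _)]
      · exact ENNReal.ofReal_le_ofReal (hZ2 k)
      · refine Integrable.of_bound (C := 1) ((hZm k).pow_const 2).aestronglyMeasurable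
          (Eventually.of_forall fun ω => ?_)
        rw [norm_pow]
        exact pow_le_one₀ (norm_nonneg _) (hZb k ω)
  filter_upwards [ae_lt_top (Measurable.tsum fun k =>
    ((hZm k).pow_const 2).ennreal_ofReal) hfin] with ω hω
  refine tendsto_average_of_tendsto_sq (hmeas.comp measurable_prodMk_right) (fun t => hG t ω) ?_
  have h1 := ENNReal.tendsto_atTop_zero_of_tsum_ne_top hω.ne
  have h2 : Tendsto (fun k => Z k ω ^ 2) atTop (𝓝 0) := by
    have h3 := (ENNReal.tendsto_toReal ENNReal.zero_ne_top).comp h1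
    refine h3.congr fun k => ?_
    simp [ENNReal.toReal_ofReal (sq_nonneg (Z k ω))]
  have h4 : Tendsto (fun k => Z k ω) atTop (𝓝 0) := by
    rw [tendsto_zero_iff_abs_tendsto_zero]
    have h5 := (Real.continuous_sqrt.tendsto 0).comp h2
    rw [Real.sqrt_zero] at h5
    refine h5.congr fun k => ?_
    simp [Real.sqrt_sq_eq_abs]
  refine h4.congr fun k => ?_
  rw [hZ, intervalIntegral.integral_of_le (by positivity)]

end TimeAverage

section JointMeasurability

variable {Ω : Type*} [MeasurableSpace Ω] {F : ℝ≥0 → Ω → ℝ}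

/-- A process with right-continuous, locally constant paths is jointly measurable. -/
theorem measurable_uncurry_of_eventually_eq (hF : ∀ t, Measurable (F t))
    (hr : ∀ ω t, ∀ᶠ s in 𝓝[>] t, F s ω = F t ω) : Measurable (Function.uncurry F) := by
  -- `q m t` is the next multiple of 1/(m+1) strictly after `t`. It takes countably many values, so
  -- `F` at time `q m t` is jointly measurable; the `+ 1` puts it in the right neighbourhood where
  -- `F` is constant.
  set q : ℕ → ℝ≥0 → ℝ≥0 := fun m t => (⌊t * (m + 1 : ℕ)⌋₊ + 1 : ℕ) / (m + 1 : ℕ) with hq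
  have hlt : ∀ m t, t < q m t := by
    intro m t
    rw [hq, lt_div_iff₀ (by positivity)]
    push_cast
    exact_mod_cast Nat.lt_floor_add_one (t * (m + 1 : ℕ))
  have hle : ∀ m t, q m t ≤ t + 1 / (m + 1 : ℕ) := by
    intro m t
    have h1 : (0 : ℝ≥0) < (m + 1 : ℕ) := by positivity
    rw [hq, div_le_iff₀ h1, add_mul, one_div, inv_mul_cancel₀ h1.ne', Nat.cast_add, Nat.cast_one]
    exact add_le_add (Nat.floor_le zero_le) le_rfl
  have hlim : ∀ t, Tendsto (fun m => q m t) atTop (𝓝[>] t) := by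
    intro t
    refine tendsto_nhdsWithin_iff.2 ⟨?_, Eventually.of_forall fun m => hlt m t⟩
    refine tendsto_of_tendsto_of_tendsto_of_le_of_le tendsto_const_nhds ?_ (fun m => (hlt m t).le)
      (fun m => hle m t)
    have h1 : Tendsto (fun m : ℕ => 1 / ((m + 1 : ℕ) : ℝ≥0)) atTop (𝓝 0) :=
      (tendsto_const_div_atTop_nhds_zero_nat 1).comp (tendsto_add_atTop_nat 1)
    simpa using h1.const_add t
  refine measurable_of_tendsto_metrizable (f := fun m x => F (q m x.1) x.2) (fun m => ?_)
    (tendsto_pi_nhds.2 fun x => ?_)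
  · have h1 : Measurable fun y : ℕ × Ω => F ((y.1 + 1 : ℕ) / (m + 1 : ℕ)) y.2 :=
      measurable_from_prod_countable_right fun k => hF ((k + 1 : ℕ) / (m + 1 : ℕ))
    have h2 : Measurable fun x : ℝ≥0 × Ω => (⌊x.1 * (m + 1 : ℕ)⌋₊, x.2) :=
      (Nat.measurable_floor.comp (measurable_fst.mul_const _)).prodMk measurable_snd
    exact h1.comp h2
  · refine tendsto_const_nhds.congr' ?_
    filter_upwards [(hlim x.1).eventually (hr x.2 x.1)] with m hm
    exact hm.symm

end JointMeasurability

section MeanFreshness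

variable {S : Type*} [Fintype S] [DecidableEq S] [MeasurableSpace S] [MeasurableSingletonClass S]
  {Ω : Type*} [MeasurableSpace Ω] {P : Measure Ω} [IsProbabilityMeasure P] {Q : Matrix S S ℝ}
  {r : ℝ≥0} {X : ℝ≥0 → Ω → S} {N : ℝ≥0 → Ω → ℕ} {x₀ : Ω → S} {p : S → ℝ} {C δ m c : ℝ}

namespace IsPoissonSampled

theorem measurable_uncurry_freshness (hS : IsPoissonSampled P Q r X N x₀) :
    Measurable (Function.uncurry (freshness X N x₀)) := by
  refine measurable_uncurry_of_eventually_eq hS.measurable_freshness fun ω t => ?_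
  filter_upwards [hS.chain.right_continuous ω t, hS.poisson.right_continuous ω t] with s h1 h2
  rw [freshness, freshness, hS.poisson.estimator_congr h2, h1]

theorem isMeanFreshness (hS : IsPoissonSampled P Q r X N x₀) (hr : 0 < r)
    (hQ : IsMixing Q p C δ) (hδ : 0 < δ) (hm : HasGridLimit Q p r m)
    (hm01 : m ∈ Set.Icc (0 : ℝ) 1) : IsMeanFreshness P X N x₀ m := by
  obtain ⟨c, hc, hcδ, hcr⟩ : ∃ c : ℝ, 0 < c ∧ 2 * c ≤ δ ∧ 2 * c ≤ r :=
    ⟨min δ r / 2, half_pos (lt_min hδ hr), by linarith [min_le_left δ (r : ℝ)],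
      by linarith [min_le_right δ (r : ℝ)]⟩
  refine ⟨hS.tendsto_measureReal_estimator_eq hQ hm hc hcδ hcr, ?_⟩
  have hmeas : Measurable (Function.uncurry fun (t : ℝ) ω => freshness X N x₀ t.toNNReal ω) :=
    hS.measurable_uncurry_freshness.comp
      ((measurable_real_toNNReal.comp measurable_fst).prodMk measurable_snd)
  have hK : 0 ≤ 2 * (Fintype.card S * C * (C + 1) + 2) := by
    have := hQ.const_nonneg
    positivity
  have h := ae_tendsto_average (P := P) (G := fun t ω => freshness X N x₀ t.toNNReal ω - m)
    (hmeas.sub_const m)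
    (fun t ω => abs_sub_le_one_of_mem_Icc (freshness_mem_Icc X N x₀ t.toNNReal ω) hm01) hK hc
    (fun s t hs hst => by
      have := hS.abs_integral_freshness_mul_le hQ hm hm01 hcδ hcr (Real.toNNReal_le_toNNReal hst)
      rwa [Real.coe_toNNReal s hs, Real.coe_toNNReal t (hs.trans hst)] at this)
  filter_upwards [h] with ω hω
  have h1 := hω.add_const m
  rw [zero_add] at h1
  refine h1.congr' ?_
  filter_upwards [eventually_gt_atTop 0] with τ hτ
  have hi : IntervalIntegrable (fun t : ℝ => freshness X N x₀ t.toNNReal ω) volume 0 τ :=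
    (intervalIntegrable_const (c := (1 : ℝ))).mono_fun'
      (hmeas.comp measurable_prodMk_right).aestronglyMeasurable
      (Eventually.of_forall fun t => by
        have := freshness_mem_Icc X N x₀ t.toNNReal ω
        exact (Real.norm_of_nonneg this.1).trans_le this.2)
  rw [intervalIntegral.integral_sub hi intervalIntegrable_const, intervalIntegral.integral_const,
    sub_zero, smul_eq_mul]
  field_simp
  ring

end IsPoissonSampled

end MeanFreshness

end SampledCTMC

/-! ### The closed form as a function of the sampling rate -/

namespace SampledCTMC

section MeanFreshnessFunction

variable {n : ℕ} {a d : Fin n → ℝ}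

theorem strictMonoOn_one_sub_sum (hn : 1 ≤ n) (ha : ∀ j, 0 < a j) (hd : ∀ j, 0 < d j) :
    StrictMonoOn (fun x => 1 - ∑ j, a j / (x + d j)) (Set.Ioi 0) := by
  have : Nonempty (Fin n) := ⟨⟨0, hn⟩⟩
  intro x hx y hy hxy
  rw [Set.mem_Ioi] at hx hy
  refine sub_lt_sub_left (Finset.sum_lt_sum_of_nonempty Finset.univ_nonempty fun j _ => ?_) 1
  have := hd j
  exact div_lt_div_of_pos_left (ha j) (by linarith) (by linarith)

theorem strictConcaveOn_one_sub_sum (hn : 1 ≤ n) (ha : ∀ j, 0 < a j) (hd : ∀ j, 0 < d j) :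
    StrictConcaveOn ℝ (Set.Ioi 0) (fun x => 1 - ∑ j, a j / (x + d j)) := by
  have : Nonempty (Fin n) := ⟨⟨0, hn⟩⟩
  -- Each summand is a positive multiple of the strictly convex function 1/x, shifted by `d j`.
  have hinv : StrictConvexOn ℝ (Set.Ioi 0) fun x : ℝ => x ^ (-1 : ℤ) :=
    strictConvexOn_zpow (by norm_num) (by norm_num)
  refine ⟨convex_Ioi 0, fun x hx y hy hxy u v hu hv huv => ?_⟩
  rw [Set.mem_Ioi] at hx hy
  have h1 : ∑ j, a j / (u • x + v • y + d j) <
      ∑ j, (u * (a j / (x + d j)) + v * (a j / (y + d j))) := by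
    refine Finset.sum_lt_sum_of_nonempty Finset.univ_nonempty fun j _ => ?_
    have hj := hd j
    have h2 := hinv.2 (x := x + d j) (Set.mem_Ioi.2 (by linarith)) (y := y + d j)
      (Set.mem_Ioi.2 (by linarith)) (fun h => hxy (add_right_cancel h)) hu hv huv
    simp only [smul_eq_mul, _root_.zpow_neg_one] at h2 ⊢
    have h3 : u * (x + d j) + v * (y + d j) = u * x + v * y + d j := by
      linear_combination d j * huv
    rw [h3] at h2
    have h4 := mul_lt_mul_of_pos_left h2 (ha j)
    simp only [div_eq_mul_inv]
    linarith
  rw [Finset.sum_add_distrib, ← Finset.mul_sum, ← Finset.mul_sum] at h1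
  simp only [smul_eq_mul] at h1 ⊢
  linarith

theorem contDiffOn_one_sub_sum (hd : ∀ j, 0 < d j) :
    ContDiffOn ℝ 1 (fun x : ℝ => 1 - ∑ j, a j / (x + d j)) (Set.Ioi 0) := by
  refine contDiffOn_const.sub (ContDiffOn.sum fun j _ => ?_)
  refine contDiffOn_const.div (contDiffOn_id.add contDiffOn_const) fun x hx => ?_
  have := hd j
  rw [Set.mem_Ioi] at hx
  exact (add_pos hx this).ne'

theorem tendsto_one_sub_sum (hd : ∀ j, 0 < d j) :
    Tendsto (fun x : ℝ => 1 - ∑ j, a j / (x + d j)) (𝓝[>] 0) (𝓝 (1 - ∑ j, a j / d j)) := by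
  refine tendsto_nhdsWithin_of_tendsto_nhds ?_
  refine tendsto_const_nhds.sub (tendsto_finsetSum _ fun j _ => ?_)
  have h1 : Tendsto (fun x : ℝ => x + d j) (𝓝 0) (𝓝 (0 + d j)) := tendsto_id.add_const (d j)
  rw [zero_add] at h1
  exact tendsto_const_nhds.div h1 (hd j).ne'

end MeanFreshnessFunction

end SampledCTMC

/-! ### Assembly of the main theorem -/

theorem corollary2 (n : ℕ)
    (Q : Matrix (Fin (n + 1)) (Fin (n + 1)) ℝ) (p : Fin (n + 1) → ℝ)
    (hQ : SampledCTMC.IsGenerator Q) (hirr : SampledCTMC.IsIrreducible Q)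
    (hp : SampledCTMC.IsStationary Q p) (hrev : SampledCTMC.IsReversible Q p)
    (U : Matrix (Fin (n + 1)) (Fin (n + 1)) ℝ) (d : Fin n → ℝ)
    (hU : Uᵀ * U = 1)
    (hdiag : Uᵀ * SampledCTMC.symmetrizedGenerator Q p * U =
      Matrix.diagonal (Fin.snoc (α := fun _ => ℝ) (fun j => -d j) 0))
    (T : Matrix (Fin (n + 1)) (Fin (n + 1)) ℝ) (hT : T = SampledCTMC.diagonalizer p U)
    (a b : Fin n → ℝ)
    (hb : ∀ j, b j = ∑ i, p i ^ 2 * T i j.castSucc ^ 2)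
    (ha : ∀ j, a j = b j * d j) :
    (∀ j, b j = ∑ i, T⁻¹ j.castSucc i ^ 2) ∧
    (∀ j, 0 < d j ∧ 0 < b j ∧ 0 < a j) ∧
    ∃ f : ℝ → ℝ,
      (∀ r : ℝ≥0, 0 < r → ∀ (Ω : Type u) [MeasurableSpace Ω] (P : Measure Ω)
        [IsProbabilityMeasure P] (X : ℝ≥0 → Ω → Fin (n + 1)) (N : ℝ≥0 → Ω → ℕ)
        (x₀ : Ω → Fin (n + 1)), SampledCTMC.IsPoissonSampled P Q r X N x₀ →
          SampledCTMC.IsMeanFreshness P X N x₀ (f r)) ∧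
      (∀ r : ℝ, 0 < r → f r = (∑ i, p i ^ 2) + r * ∑ j, b j / (r + d j)) ∧
      (∀ r : ℝ, 0 < r → f r = 1 - ∑ j, a j / (r + d j)) ∧
      (1 ≤ n → StrictMonoOn f (Set.Ioi 0) ∧ StrictConcaveOn ℝ (Set.Ioi 0) f) ∧
      DifferentiableOn ℝ f (Set.Ioi 0) ∧ ContinuousOn (deriv f) (Set.Ioi 0) ∧
      Tendsto f (𝓝[>] 0) (𝓝 (∑ i, p i ^ 2)) := by
  subst hT
  have hpos := hp.pos hirr hrev
  have hd := SampledCTMC.decay_rate_pos hQ hirr hp hpos hU hdiag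
  have hb0 : ∀ j, 0 < b j := fun j => by
    rw [hb]
    exact SampledCTMC.sum_sq_mul_diagonalizer_pos hpos hU _
  have ha0 : ∀ j, 0 < a j := fun j => by
    rw [ha]
    exact mul_pos (hb0 j) (hd j)
  have hsum : ∑ i, p i ^ 2 + ∑ j, b j = 1 := by
    simp only [hb]
    exact SampledCTMC.sum_sq_add_sum_eq_one hQ hirr hp hpos hU hdiag
  -- Termwise r b/(r+d) = b - a/(r+d), and `hsum` collects the constants.
  have hf : ∀ r : ℝ, 0 < r →
      1 - ∑ j, a j / (r + d j) = (∑ i, p i ^ 2) + r * ∑ j, b j / (r + d j) := by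
    intro r hr
    have h1 : r * ∑ j, b j / (r + d j) = ∑ j, b j - ∑ j, a j / (r + d j) := by
      rw [Finset.mul_sum, ← Finset.sum_sub_distrib]
      refine Finset.sum_congr rfl fun j _ => ?_
      have := hd j
      rw [ha]
      field_simp
      ring
    rw [h1, ← hsum]
    ring
  obtain ⟨C, δ, hC, hδ, hdecay⟩ :=
    SampledCTMC.exists_abs_transitionProb_sub_le hQ hirr hp hpos hU hdiag
  have hmix : SampledCTMC.IsMixing Q p C δ := by
    refine ⟨hC, hδ.le, fun j => ?_, hdecay⟩
    rw [abs_of_nonneg (hp.nonneg j), ← hp.sum_eq_one]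
    exact Finset.single_le_sum (fun i _ => hp.nonneg i) (Finset.mem_univ j)
  -- The witness is the closed form itself, chosen before any probability space or process, so the
  -- mean freshness depends on `Q` and the rate alone.
  refine ⟨fun j => ?_, fun j => ⟨hd j, hb0 j, ha0 j⟩, fun x => 1 - ∑ j, a j / (x + d j),
    ?_, hf, fun _ _ => rfl, fun hn => ⟨SampledCTMC.strictMonoOn_one_sub_sum hn ha0 hd,
      SampledCTMC.strictConcaveOn_one_sub_sum hn ha0 hd⟩,
    (SampledCTMC.contDiffOn_one_sub_sum hd).differentiableOn one_ne_zero,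
    (SampledCTMC.contDiffOn_one_sub_sum hd).continuousOn_deriv_of_isOpen isOpen_Ioi le_rfl, ?_⟩
  · rw [hb]
    refine Finset.sum_congr rfl fun i _ => ?_
    rw [SampledCTMC.diagonalizer_inv_apply hpos hU, mul_pow]
  · intro r hr Ω _ P _ X N x₀ hS
    have hr' : (0 : ℝ) < r := hr
    refine hS.isMeanFreshness hr hmix hδ ?_ ⟨?_, ?_⟩
    · simp only [hf r hr']
      refine SampledCTMC.hasGridLimit_of_returnProb hr (Finset.sum_nonneg fun i _ => sq_nonneg _)
        (fun j => (hb0 j).le) (fun j => (hd j).le) hsum fun v => ?_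
      simp only [hb]
      exact SampledCTMC.sum_mul_transitionProb hQ hirr hp hpos hU hdiag v
    · simp only [hf r hr']
      refine add_nonneg (Finset.sum_nonneg fun i _ => sq_nonneg _) (mul_nonneg hr'.le
        (Finset.sum_nonneg fun j _ => ?_))
      exact div_nonneg (hb0 j).le (add_pos hr' (hd j)).le
    · simp only [sub_le_self_iff]
      exact Finset.sum_nonneg fun j _ => div_nonneg (ha0 j).le (add_pos hr' (hd j)).le
  · have h1 : 1 - ∑ j, a j / d j = ∑ i, p i ^ 2 := by
      have h2 : ∑ j, a j / d j = ∑ j, b j := Finset.sum_congr rfl fun j _ => by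
        rw [ha, mul_div_cancel_right₀ _ (hd j).ne']
      rw [h2]
      linarith
    rw [← h1]
    exact SampledCTMC.tendsto_one_sub_sum hd
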